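/- **Language.** Let $Var$ be a (finite or infinite) set of variables and $(Pred,ar)$ a set of predicate symbols with arities. Formulas of $\mathsf{LUD}$ are $$\varphi ::= Px_1\ldots x_n \mid \neg\varphi \mid \varphi\wedge\varphi \mid D_X\varphi \mid D_XY \mid K_X\varphi \mid K_XY \mid U(X;Y),$$ with $n=ar(P)$, $x_i\in Var$, and $X,Y\subseteq Var$ finite. Abbreviate $A\varphi:=D_\emptyset\varphi$, $C(Y):=D_\emptyset Y$, $K\varphi:=K_\emptyset\varphi$, $K(Y):=K_\emptyset Y$, $K(X;Y):=K_\emptyset K_XY$. **Models.** A metric dependence model consists of metric spaces $(\mathbb D_x,d_x)$ for $x\in Var$, for each $P$ an $ar(P)$-ary relation $I(P)$ on $\bigcup_x\mathbb D_x$, a set $S$ of states, and surjections $\mathbf x:S\to\mathbb D_x$. For finite $X\subseteq Var$ put $\mathbf X(s)=(\mathbf x(s))_{x\in X}$, with values in the finite product of the spaces $\mathbb D_x$, and $d_X^S(s,t)=\sup\{d_x(\mathbf x(s),\mathbf x(t)):x\in X\}$ (with $\sup\emptyset=0$); the $X$-topology on $S$ is the one induced by $\mathbf X$ (equivalently by $d^S_X$).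 The model is *concrete* if $S\subseteq\prod_x\mathbb D_x$ and $\mathbf x(s)=s(x)$. A map $F$ between pseudo-metric spaces is *pseudo-locally Lipschitz* if every point $a$ has an open neighbourhood $O$, and $F(a)$ an open neighbourhood $V$, such that $F$ is Lipschitz on $O\cap F^{-1}(V)$. A metric dependence model is *pseudo-locally Lipschitz* if for all $x,y\in Var$ with $\mathbf x$ not constant, the map $\mathbf y:(S,d^S_{\{x\}})\to(\mathbb D_y,d_y)$ is pseudo-locally Lipschitz. **Semantics.** $s\models Px_1\ldots x_n$ iff $(\mathbf x_1(s),\ldots,\mathbf x_n(s))\in I(P)$; Boolean clauses as usual; $s\models D_X\varphi$ iff $w\models\varphi$ for all $w\in S$ with $\mathbf X(w)=\mathbf X(s)$; $s\models D_XY$ iff $\mathbf Y(w)=\mathbf Y(s)$ for all such $w$; $s\models K_X\varphi$ iff $s$ is in the interior of $\{w:w\models\varphi\}$ in the $X$-topology; $s\models K_XY$ iff there are an $X$-open $O\ni s$ and a continuous $F$ on $\mathbf X(O)$ with $F\circ\mathbf X=\mathbf Y$ on $O$; $s\models U(X;Y)$ iff $\forall\varepsilon>0\,\exists\delta>0\,\forall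 s,t\in S\,(d_X^S(s,t)<\delta\Rightarrow d_Y^S(s,t)<\varepsilon)$. A formula is valid on a class of models if it is true at every state of every model of the class. **Proof system $\mathbf{LUD}$.** All instances of propositional tautologies, and modus ponens; * necessitation (from $\varphi$ infer $D_X\varphi$), distribution $D_X(\varphi\to\psi)\to(D_X\varphi\to D_X\psi)$, $D_X\varphi\to\varphi$, $D_X\varphi\to D_XD_X\varphi$, $\neg D_X\varphi\to D_X\neg D_X\varphi$; * $D_XY$ for $Y\subseteq X$; $(D_XY\wedge D_XZ)\to D_X(Y\cup Z)$; $(D_XY\wedge D_YZ)\to D_XZ$; $D_XY\to D_XD_XY$; $D_XY\to(D_Y\varphi\to D_X\varphi)$; $Px_1\ldots x_n\to D_{\{x_1,\ldots,x_n\}}Px_1\ldots x_n$; * necessitation (from $\varphi$ infer $K_X\varphi$), distribution $K_X(\varphi\to\psi)\to(K_X\varphi\to K_X\psi)$, $K_X\varphi\to\varphi$, $K_X\varphi\to K_XK_X\varphi$; * $K_XY$ for $Y\subseteq X$; $(K_XY\wedge K_XZ)\to K_X(Y\cup Z)$; $(K_XY\wedge K_YZ)\to K_XZ$; $K_XY\to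 K_XK_XY$; $K_XY\to(K_Y\varphi\to K_X\varphi)$; * $K_X\varphi\to D_X\varphi$; $K_XY\to D_XY$; $A\varphi\to K\varphi$; $C(Y)\to K(Y)$; * $U(X;Y)$ for $Y\subseteq X$; $(U(X;Y)\wedge U(X;Z))\to U(X;Y\cup Z)$; $(U(X;Y)\wedge U(Y;Z))\to U(X;Z)$; $U(X;Y)\to K\,U(X;Y)$; $U(X;Y)\to K(X;Y)$; $K(Y)\to U(X;Y)$. **Theorem.** For every formula $\varphi$ of $\mathsf{LUD}$ the following are equivalent: (a) $\varphi$ is a theorem of $\mathbf{LUD}$; (b) $\varphi$ is valid on all metric dependence models; (c) $\varphi$ is valid on all concrete metric models; (d) $\varphi$ is valid on all pseudo-locally Lipschitz models. Moreover, the logic is decidable: if $Var$ and $Pred$ are countable (given with injective numberings), there is a total recursive function that decides, from the Gödel number of a formula, whether the formula is valid on all metric dependence models. -/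

import Mathlib

universe u

namespace LUD

/-! ### Syntax -/

/-- Formulas of the logic of uniform dependence, over the variables `Var` and the relational
vocabulary `(Pred, ar)`:
`P x⃗ | ¬φ | φ ∧ φ | D_X φ | D_X Y | K_X φ | K_X Y | U(X;Y)`, with `X`, `Y` finite sets of
variables. -/
inductive Formula (Var : Type u) {Pred : Type u} (ar : Pred → ℕ) : Type u
  | pred (P : Pred) (xs : Fin (ar P) → Var) : Formula Var ar
  | neg (φ : Formula Var ar) : Formula Var ar
  | and (φ ψ : Formula Var ar) : Formula Var ar
  | D (X : Finset Var) (φ : Formula Var ar) : Formula Var ar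
  | Dep (X Y : Finset Var) : Formula Var ar
  | K (X : Finset Var) (φ : Formula Var ar) : Formula Var ar
  | KDep (X Y : Finset Var) : Formula Var ar
  | UDep (X Y : Finset Var) : Formula Var ar

namespace Formula

variable {Var Pred : Type u} {ar : Pred → ℕ}

/-- `φ → ψ := ¬(φ ∧ ¬ψ)`. -/
def imp (φ ψ : Formula Var ar) : Formula Var ar := neg (and φ (neg ψ))

/-- `A φ := D_∅ φ`. -/
def all (φ : Formula Var ar) : Formula Var ar := D ∅ φ

/-- `C(Y) := D_∅ Y`. -/
def const (Y : Finset Var) : Formula Var ar := Dep ∅ Y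

/-- `K φ := K_∅ φ`. -/
def known (φ : Formula Var ar) : Formula Var ar := K ∅ φ

/-- `K(Y) := K_∅ Y`. -/
def knownVal (Y : Finset Var) : Formula Var ar := KDep ∅ Y

/-- `K(X;Y) := K K_X Y`. -/
def knownDep (X Y : Finset Var) : Formula Var ar := known (KDep X Y)

/-- Instances of classical propositional tautologies: formulas true under every truth assignment
to formulas that respects `¬` and `∧`. -/
def IsTautology (φ : Formula Var ar) : Prop :=
  ∀ v : Formula Var ar → Prop, (∀ ψ, v (neg ψ) ↔ ¬ v ψ) →
    (∀ ψ χ, v (and ψ χ) ↔ v ψ ∧ v χ) → v φ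

end Formula

/-! ### The proof system -/

section ProofSystem

open Formula

variable {Var Pred : Type u} [DecidableEq Var] {ar : Pred → ℕ}

/-- The theorems of the proof system **LUD**. -/
inductive Provable : Formula Var ar → Prop
  -- propositional logic
  | taut (φ : Formula Var ar) : IsTautology φ → Provable φ
  | modusPonens (φ ψ : Formula Var ar) : Provable (imp φ ψ) → Provable φ → Provable ψ
  -- `S5` for determination
  | dNec (X : Finset Var) (φ : Formula Var ar) : Provable φ → Provable (D X φ)
  | dDist (X : Finset Var) (φ ψ : Formula Var ar) :
      Provable (imp (D X (imp φ ψ)) (imp (D X φ) (D X ψ)))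
  | dFactivity (X : Finset Var) (φ : Formula Var ar) : Provable (imp (D X φ) φ)
  | dFour (X : Finset Var) (φ : Formula Var ar) : Provable (imp (D X φ) (D X (D X φ)))
  | dFive (X : Finset Var) (φ : Formula Var ar) :
      Provable (imp (neg (D X φ)) (D X (neg (D X φ))))
  -- exact dependence
  | inclusion (X Y : Finset Var) : Y ⊆ X → Provable (Dep X Y)
  | additivity (X Y Z : Finset Var) :
      Provable (imp (and (Dep X Y) (Dep X Z)) (Dep X (Y ∪ Z)))
  | transitivity (X Y Z : Finset Var) :
      Provable (imp (and (Dep X Y) (Dep Y Z)) (Dep X Z))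
  | determinedDep (X Y : Finset Var) : Provable (imp (Dep X Y) (D X (Dep X Y)))
  | transfer (X Y : Finset Var) (φ : Formula Var ar) :
      Provable (imp (Dep X Y) (imp (D Y φ) (D X φ)))
  | determinedAtoms (P : Pred) (xs : Fin (ar P) → Var) :
      Provable (imp (pred P xs) (D (Finset.univ.image xs) (pred P xs)))
  -- `S4` for knowability
  | kNec (X : Finset Var) (φ : Formula Var ar) : Provable φ → Provable (K X φ)
  | kDist (X : Finset Var) (φ ψ : Formula Var ar) :
      Provable (imp (K X (imp φ ψ)) (imp (K X φ) (K X ψ)))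
  | veracity (X : Finset Var) (φ : Formula Var ar) : Provable (imp (K X φ) φ)
  | posIntrospection (X : Finset Var) (φ : Formula Var ar) :
      Provable (imp (K X φ) (K X (K X φ)))
  -- knowable dependence
  | kInclusion (X Y : Finset Var) : Y ⊆ X → Provable (KDep X Y)
  | kAdditivity (X Y Z : Finset Var) :
      Provable (imp (and (KDep X Y) (KDep X Z)) (KDep X (Y ∪ Z)))
  | kTransitivity (X Y Z : Finset Var) :
      Provable (imp (and (KDep X Y) (KDep Y Z)) (KDep X Z))
  | knowabilityOfDep (X Y : Finset Var) : Provable (imp (KDep X Y) (K X (KDep X Y)))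
  | kTransfer (X Y : Finset Var) (φ : Formula Var ar) :
      Provable (imp (KDep X Y) (imp (K Y φ) (K X φ)))
  -- connecting axioms
  | knowableDetermination (X : Finset Var) (φ : Formula Var ar) : Provable (imp (K X φ) (D X φ))
  | knowableDependence (X Y : Finset Var) : Provable (imp (KDep X Y) (Dep X Y))
  | knowledgeOfNecessity (φ : Formula Var ar) : Provable (imp (all φ) (known φ))
  | knowledgeOfConstants (Y : Finset Var) : Provable (imp (const Y) (knownVal Y))
  -- uniform dependence
  | uInclusion (X Y : Finset Var) : Y ⊆ X → Provable (UDep X Y)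
  | uAdditivity (X Y Z : Finset Var) :
      Provable (imp (and (UDep X Y) (UDep X Z)) (UDep X (Y ∪ Z)))
  | uTransitivity (X Y Z : Finset Var) :
      Provable (imp (and (UDep X Y) (UDep Y Z)) (UDep X Z))
  | uKnown (X Y : Finset Var) : Provable (imp (UDep X Y) (known (UDep X Y)))
  | uContinuity (X Y : Finset Var) : Provable (imp (UDep X Y) (knownDep X Y))
  | uKnowledge (X Y : Finset Var) : Provable (imp (knownVal Y) (UDep X Y))

end ProofSystem

/-! ### Models -/

/-- A typed metric model: a range of values `Rng x` with a metric for every variable `x`, and an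
interpretation of each predicate symbol as a relation on the union of all the ranges. The ranges
are subsets of an ambient type `Val`, which may overlap. -/
structure TypedMetricModel (Var : Type u) {Pred : Type u} (ar : Pred → ℕ) where
  Val : Type u
  Rng : Var → Set Val
  metric : ∀ x, MetricSpace (Rng x)
  interp : ∀ P : Pred, Set (Fin (ar P) → (⋃ x, Rng x : Set Val))

attribute [instance] TypedMetricModel.metric

/-- A metric dependence model: a typed metric model, a set of states, and for every variable a
surjective map from the states to its range of values. -/
structure MetricModel (Var : Type u) {Pred : Type u} (ar : Pred → ℕ)
    extends TypedMetricModel Var ar where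
  State : Type u
  val : ∀ x, State → Rng x
  surj : ∀ x, Function.Surjective (val x)

/-- A concrete metric model: a typed metric model and a set of type-respecting assignments of
values to variables, such that every value in each range is taken. -/
structure ConcreteMetricModel (Var : Type u) {Pred : Type u} (ar : Pred → ℕ)
    extends TypedMetricModel Var ar where
  States : Set (∀ x, Rng x)
  range_eq : ∀ x, {a | ∃ s ∈ States, s x = a} = Set.univ

namespace ConcreteMetricModel

variable {Var Pred : Type u} {ar : Pred → ℕ}

/-- A concrete metric model as a metric dependence model, with `𝐱(s) := s(x)`. -/
def toMetricModel (M : ConcreteMetricModel Var ar) : MetricModel Var ar where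
  toTypedMetricModel := M.toTypedMetricModel
  State := M.States
  val x s := s.1 x
  surj x a := by
    have h : a ∈ {a | ∃ s ∈ M.States, s x = a} := by rw [M.range_eq x]; trivial
    obtain ⟨s, hs, rfl⟩ := h
    exact ⟨⟨s, hs⟩, rfl⟩

end ConcreteMetricModel

/-- A map between pseudo-metric spaces is pseudo-locally Lipschitz if every point `a` has an open
neighbourhood `O`, and `F a` an open neighbourhood `V`, such that `F` is Lipschitz on
`O ∩ F⁻¹(V)`. -/
def PseudoLocallyLipschitz {α β : Type*} [PseudoMetricSpace α] [PseudoMetricSpace β]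
    (F : α → β) : Prop :=
  ∀ a, ∃ O : Set α, ∃ V : Set β, IsOpen O ∧ a ∈ O ∧ IsOpen V ∧ F a ∈ V ∧
    ∃ C : NNReal, LipschitzOnWith C F (O ∩ F ⁻¹' V)

namespace MetricModel

variable {Var Pred : Type u} {ar : Pred → ℕ}

/-- The joint variable `𝐗(s) = (𝐱(s))_{x ∈ X}`. The product over the finite set `X` carries
Mathlib's product metric, which is the Chebyshev distance (`0` for `X = ∅`), and the product
topology. -/
def joint (M : MetricModel Var ar) (X : Finset Var) (s : M.State) : ∀ x : X, M.Rng x :=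
  fun x => M.val x s

/-- The `𝐗`-topology on the states: preimages under `𝐗` of the open sets. -/
@[reducible]
def stateTopology (M : MetricModel Var ar) (X : Finset Var) : TopologicalSpace M.State :=
  TopologicalSpace.induced (M.joint X) inferInstance

/-- The pseudo-metric `d_X^S(s,t) = sup {d_x(𝐱(s),𝐱(t)) : x ∈ X}` on the states. -/
noncomputable def stateDist (M : MetricModel Var ar) (X : Finset Var) (s t : M.State) : ℝ :=
  dist (M.joint X s) (M.joint X t)

/-- The satisfaction relation `s ⊨ φ`. In the clause for `K_X Y` the function `F` is only relevant
on `𝐗(O)`. -/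
def Sat (M : MetricModel Var ar) : Formula Var ar → M.State → Prop
  | .pred P xs, s =>
      (fun i => ⟨M.val (xs i) s, Set.mem_iUnion.2 ⟨xs i, (M.val (xs i) s).2⟩⟩) ∈ M.interp P
  | .neg φ, s => ¬ M.Sat φ s
  | .and φ ψ, s => M.Sat φ s ∧ M.Sat ψ s
  | .D X φ, s => ∀ w, M.joint X s = M.joint X w → M.Sat φ w
  | .Dep X Y, s => ∀ w, M.joint X s = M.joint X w → M.joint Y s = M.joint Y w
  | .K X φ, s => s ∈ @interior M.State (M.stateTopology X) {w | M.Sat φ w}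
  | .KDep X Y, s => ∃ O : Set M.State, @IsOpen M.State (M.stateTopology X) O ∧ s ∈ O ∧
      ∃ F : (∀ x : X, M.Rng x) → (∀ y : Y, M.Rng y),
        ContinuousOn F (M.joint X '' O) ∧ ∀ w ∈ O, F (M.joint X w) = M.joint Y w
  | .UDep X Y, _ => ∀ ε > 0, ∃ δ > 0, ∀ s t : M.State,
      M.stateDist X s t < δ → M.stateDist Y s t < ε

/-- Truth at all states. -/
def Valid (M : MetricModel Var ar) (φ : Formula Var ar) : Prop := ∀ s, M.Sat φ s

/-- A basic variable is constant if it takes at most one value. -/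
def IsConstant (M : MetricModel Var ar) (x : Var) : Prop := ∀ s t, M.val x s = M.val x t

/-- Pseudo-locally Lipschitz models: every basic variable `y` is pseudo-locally Lipschitz with
respect to every non-constant basic variable `x`, i.e. as a map from the states, with the
pseudo-metric `d_x^S(s,t) = d_x(𝐱(s),𝐱(t))`, to the range of `y`. For a constant `x` this
pseudo-metric is identically zero, as it is for the empty set of variables. -/
def IsPseudoLocallyLipschitz (M : MetricModel Var ar) : Prop :=
  ∀ x y : Var, ¬ M.IsConstant x →
    @PseudoLocallyLipschitz M.State (M.Rng y)
      (PseudoMetricSpace.induced (M.val x) inferInstance) inferInstance (M.val y)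

end MetricModel

/-! ### Validity on the classes of models -/

section Validity

variable {Var Pred : Type u} {ar : Pred → ℕ}

/-- Validity on all metric dependence models. -/
def MetricValid (φ : Formula Var ar) : Prop := ∀ M : MetricModel Var ar, M.Valid φ

/-- Validity on all concrete metric models. -/
def ConcreteValid (φ : Formula Var ar) : Prop :=
  ∀ M : ConcreteMetricModel Var ar, M.toMetricModel.Valid φ

/-- Validity on all pseudo-locally Lipschitz models. -/
def LipschitzValid (φ : Formula Var ar) : Prop :=
  ∀ M : MetricModel Var ar, M.IsPseudoLocallyLipschitz → M.Valid φ

end Validity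

/-! ### Gödel numbers of formulas -/

namespace Formula

variable {Var Pred : Type u} [Encodable Var] [Encodable Pred] {ar : Pred → ℕ}

/-- The code of a finite set of variables: the number whose binary digits form the indicator
sequence of the set of their numbers. -/
def codeSet (X : Finset Var) : ℕ := ∑ x ∈ X, 2 ^ Encodable.encode x

/-- The Gödel number of a formula, relative to a numbering of the variables and predicates. -/
def code : Formula Var ar → ℕ
  | pred P xs => Nat.pair 0 (Nat.pair (Encodable.encode P)
      (Encodable.encode (List.ofFn fun i => Encodable.encode (xs i))))
  | neg φ => Nat.pair 1 φ.code
  | and φ ψ => Nat.pair 2 (Nat.pair φ.code ψ.code)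
  | D X φ => Nat.pair 3 (Nat.pair (codeSet X) φ.code)
  | Dep X Y => Nat.pair 4 (Nat.pair (codeSet X) (codeSet Y))
  | K X φ => Nat.pair 5 (Nat.pair (codeSet X) φ.code)
  | KDep X Y => Nat.pair 6 (Nat.pair (codeSet X) (codeSet Y))
  | UDep X Y => Nat.pair 7 (Nat.pair (codeSet X) (codeSet Y))

theorem codeSet_injective : Function.Injective (codeSet : Finset Var → ℕ) := by
  intro X Y h
  have key : ∀ Z : Finset Var,
      codeSet Z = ∑ n ∈ Z.map ⟨Encodable.encode, Encodable.encode_injective⟩, 2 ^ n := by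
    intro Z; simp [codeSet]
  rw [key, key] at h
  exact Finset.map_injective _ (Finset.geomSum_injective le_rfl h)

theorem code_injective : Function.Injective (code : Formula Var ar → ℕ) := by
  intro φ
  induction φ with
  | pred P xs =>
    intro ψ h
    cases ψ <;> simp only [code, Nat.pair_eq_pair] at h <;> try omega
    obtain ⟨-, hP, hx⟩ := h
    obtain rfl := Encodable.encode_injective hP
    have := List.ofFn_injective (Encodable.encode_injective hx)
    congr
    funext i
    exact Encodable.encode_injective (congrFun this i)
  | neg φ ih =>
    intro ψ h
    cases ψ <;> simp only [code, Nat.pair_eq_pair] at h <;> try omega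
    rw [ih h.2]
  | and φ χ ih₁ ih₂ =>
    intro ψ h
    cases ψ <;> simp only [code, Nat.pair_eq_pair] at h <;> try omega
    rw [ih₁ h.2.1, ih₂ h.2.2]
  | D X φ ih =>
    intro ψ h
    cases ψ <;> simp only [code, Nat.pair_eq_pair] at h <;> try omega
    rw [ih h.2.2, codeSet_injective h.2.1]
  | K X φ ih =>
    intro ψ h
    cases ψ <;> simp only [code, Nat.pair_eq_pair] at h <;> try omega
    rw [ih h.2.2, codeSet_injective h.2.1]
  | Dep X Y =>
    intro ψ h
    cases ψ <;> simp only [code, Nat.pair_eq_pair] at h <;> try omega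
    rw [codeSet_injective h.2.1, codeSet_injective h.2.2]
  | KDep X Y =>
    intro ψ h
    cases ψ <;> simp only [code, Nat.pair_eq_pair] at h <;> try omega
    rw [codeSet_injective h.2.1, codeSet_injective h.2.2]
  | UDep X Y =>
    intro ψ h
    cases ψ <;> simp only [code, Nat.pair_eq_pair] at h <;> try omega
    rw [codeSet_injective h.2.1, codeSet_injective h.2.2]

end Formula

/-- A set of formulas is decidable if a total recursive function decides membership from the
Gödel number of a formula. -/
def DecidableFormulas {Var Pred : Type u} [Encodable Var] [Encodable Pred] {ar : Pred → ℕ}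
    (T : Formula Var ar → Prop) : Prop :=
  ∃ f : ℕ → Bool, Computable f ∧ ∀ φ : Formula Var ar, f φ.code = true ↔ T φ

end LUD

/-!
Soundness. Let `nhdsOn X s` and `uniformityOn X` be the neighbourhood filter and the uniformity
induced by `𝐗`. Then `K_X φ` says that `φ` holds eventually along `nhdsOn X s`, `K_X Y` says that
`nhdsOn X ≤ nhdsOn Y` at all points near `s`, and `U(X; Y)` says that
`uniformityOn X ≤ uniformityOn Y`, so that the axioms become order properties of filters. Sending a
state to its assignment maps a model onto a concrete one and preserves truth.

Completeness. An unprovable formula is refuted at a maximal theory, and the maximal theories that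
agree with it on `D_∅` form a *quasi-model* `W`: a set of types in which every failure of `D_X ψ` or
`K_X ψ` has a witness. The states of the model refuting the formula are the paths in `W`; an edge
either keeps some `X` fixed, or changes `X` by about `1 / (n + 1)`. In the metric of `x`, the
distance between two paths is the largest change of `x` along an edge on the way from one to the
other. Along an edge of the second kind the change of `x` is `1 / (n + 1)` if `x` depends uniformly
on `X`, and `min 1 ((N + 1) / (n + 1))` if it only depends continuously on `X`. The number `N` is
part of the node and can only be altered by a jump, so it is constant on small balls, where it
provides a Lipschitz constant; as it is unbounded over the whole tree, the dependence is not
uniform.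

Decidability. The argument applies to every quasi-model, and only finitely many formulas matter for
whether a set of types is one. Hence a refutable formula is refuted by a quasi-model whose code is
bounded in terms of the formula, and searching below this bound is primitive recursive.
-/

namespace LUD

open Formula Filter Topology Uniformity
open scoped NNReal

namespace MetricModel

variable {Var Pred : Type u} {ar : Pred → ℕ} (M : MetricModel Var ar)

theorem joint_eq_iff {X : Finset Var} {s t : M.State} :
    M.joint X s = M.joint X t ↔ ∀ x ∈ X, M.val x s = M.val x t := by
  simp [joint, funext_iff]

theorem joint_eq_of_subset {X Y : Finset Var} {s t : M.State} (h : Y ⊆ X)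
    (hX : M.joint X s = M.joint X t) : M.joint Y s = M.joint Y t :=
  M.joint_eq_iff.2 fun y hy => M.joint_eq_iff.1 hX y (h hy)

theorem joint_union_eq [DecidableEq Var] {Y Z : Finset Var} {s t : M.State}
    (hY : M.joint Y s = M.joint Y t) (hZ : M.joint Z s = M.joint Z t) :
    M.joint (Y ∪ Z) s = M.joint (Y ∪ Z) t := by
  rw [joint_eq_iff] at hY hZ ⊢
  exact fun x hx => (Finset.mem_union.1 hx).elim (hY x) (hZ x)

theorem stateDist_lt_iff {X : Finset Var} {s t : M.State} {ε : ℝ} (hε : 0 < ε) :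
    M.stateDist X s t < ε ↔ ∀ x ∈ X, dist (M.val x s) (M.val x t) < ε := by
  simp [stateDist, dist_pi_lt_iff hε, joint]

/-- The neighbourhood filter of the state `s` in the `X`-topology. In terms of these filters `K_X`
is "eventually", and a dependence is local continuity when `nhdsOn X` is finer than `nhdsOn Y`. -/
def nhdsOn (X : Finset Var) (s : M.State) : Filter M.State :=
  comap (M.joint X) (𝓝 (M.joint X s))

/-- The uniformity on the states induced by `𝐗`; a uniform dependence of `Y` on `X` says that it is
finer than the one induced by `𝐘`. -/
def uniformityOn (X : Finset Var) : Filter (M.State × M.State) :=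
  comap (Prod.map (M.joint X) (M.joint X)) (𝓤 (∀ x : X, M.Rng x))

theorem nhdsOn_basis (X : Finset Var) (s : M.State) :
    (M.nhdsOn X s).HasBasis (fun ε : ℝ => 0 < ε) fun ε => {w | M.stateDist X s w < ε} := by
  simpa only [stateDist, dist_comm (M.joint X s)] using!
    (Metric.nhds_basis_ball (x := M.joint X s)).comap (M.joint X)

theorem uniformityOn_basis (X : Finset Var) :
    (M.uniformityOn X).HasBasis (fun ε : ℝ => 0 < ε) fun ε => {p | M.stateDist X p.1 p.2 < ε} :=
  Metric.uniformity_basis_dist.comap _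

theorem nhds_stateTopology (X : Finset Var) (s : M.State) :
    @nhds M.State (M.stateTopology X) s = M.nhdsOn X s :=
  nhds_induced (M.joint X) s

theorem nhdsOn_eq_iInf (X : Finset Var) (s : M.State) :
    M.nhdsOn X s = ⨅ x ∈ X, comap (M.val x) (𝓝 (M.val x s)) := by
  simp only [nhdsOn, nhds_pi, Filter.pi, comap_iInf, comap_comap, iInf_subtype]
  rfl

theorem uniformityOn_eq_iInf (X : Finset Var) :
    M.uniformityOn X = ⨅ x ∈ X, comap (Prod.map (M.val x) (M.val x)) (𝓤 (M.Rng x)) := by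
  simp only [uniformityOn, Pi.uniformity, comap_iInf, comap_comap, iInf_subtype]
  rfl

theorem nhdsOn_anti {X Y : Finset Var} (h : Y ⊆ X) (s : M.State) :
    M.nhdsOn X s ≤ M.nhdsOn Y s := by
  simpa only [nhdsOn_eq_iInf] using biInf_mono h

theorem uniformityOn_anti {X Y : Finset Var} (h : Y ⊆ X) :
    M.uniformityOn X ≤ M.uniformityOn Y := by
  simpa only [uniformityOn_eq_iInf] using biInf_mono h

theorem nhdsOn_union [DecidableEq Var] (Y Z : Finset Var) (s : M.State) :
    M.nhdsOn (Y ∪ Z) s = M.nhdsOn Y s ⊓ M.nhdsOn Z s := by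
  simp only [nhdsOn_eq_iInf, Finset.iInf_union]

theorem uniformityOn_union [DecidableEq Var] (Y Z : Finset Var) :
    M.uniformityOn (Y ∪ Z) = M.uniformityOn Y ⊓ M.uniformityOn Z := by
  simp only [uniformityOn_eq_iInf, Finset.iInf_union]

theorem nhdsOn_eq_comap_uniformityOn (X : Finset Var) (s : M.State) :
    M.nhdsOn X s = comap (Prod.mk s) (M.uniformityOn X) := by
  rw [nhdsOn, uniformityOn, nhds_eq_comap_uniformity, comap_comap, comap_comap]
  rfl

theorem pure_le_nhdsOn (X : Finset Var) (s : M.State) : pure s ≤ M.nhdsOn X s :=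
  map_le_iff_le_comap.1 (by simpa only [map_pure] using pure_le_nhds _)

variable {M} in
theorem eventually_nhdsOn_self {X : Finset Var} {s : M.State} {p : M.State → Prop}
    (h : ∀ᶠ w in M.nhdsOn X s, p w) : p s :=
  M.pure_le_nhdsOn X s h

variable {M} in
theorem nhdsOn_congr {X : Finset Var} {s w : M.State} (h : M.joint X s = M.joint X w) :
    M.nhdsOn X s = M.nhdsOn X w := by
  rw [nhdsOn, h, nhdsOn]

variable {M} in
theorem joint_eq_of_nhdsOn_le {X Y : Finset Var} {s w : M.State}
    (h : M.nhdsOn X s ≤ M.nhdsOn Y s) (hw : M.joint X s = M.joint X w) :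
    M.joint Y s = M.joint Y w := by
  have hle : pure w ≤ M.nhdsOn Y s :=
    (M.pure_le_nhdsOn X w).trans ((nhdsOn_congr hw).symm.le.trans h)
  rw [nhdsOn, ← map_le_iff_le_comap, map_pure, pure_le_nhds_iff] at hle
  exact hle.symm

theorem uniformityOn_eq_top {Y : Finset Var} (h : ∀ s t, M.joint Y s = M.joint Y t) :
    M.uniformityOn Y = ⊤ := by
  refine top_le_iff.1 (map_le_iff_le_comap.1 (le_trans ?_ refl_le_uniformity))
  exact le_principal_iff.2 (mem_map.2 (univ_mem' fun p => h p.1 p.2))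

variable {M} in
theorem eventually_eventually_nhdsOn {X : Finset Var} {s : M.State} {p : M.State → Prop} :
    (∀ᶠ w in M.nhdsOn X s, ∀ᶠ w' in M.nhdsOn X w, p w') ↔ ∀ᶠ w in M.nhdsOn X s, p w := by
  simp only [← nhds_stateTopology]
  exact @eventually_eventually_nhds M.State (M.stateTopology X) s p

theorem sat_K {X : Finset Var} {φ : Formula Var ar} {s : M.State} :
    M.Sat (K X φ) s ↔ ∀ᶠ w in M.nhdsOn X s, M.Sat φ w := by
  rw [← nhds_stateTopology]
  exact @mem_interior_iff_mem_nhds M.State (M.stateTopology X) _ _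

theorem sat_KDep {X Y : Finset Var} {s : M.State} :
    M.Sat (KDep X Y) s ↔ ∀ᶠ w in M.nhdsOn X s, M.nhdsOn X w ≤ M.nhdsOn Y w := by
  let _ := M.stateTopology X
  have hX : IsInducing (M.joint X) := ⟨rfl⟩
  rw [← nhds_stateTopology]
  constructor
  · rintro ⟨O, hO, hs, F, hF, hFO⟩
    filter_upwards [hO.mem_nhds hs] with w hw
    have hjoint : Tendsto (M.joint X) (𝓝 w) (𝓝[M.joint X '' O] M.joint X w) :=
      tendsto_nhdsWithin_of_tendsto_nhds_of_eventually_within _ hX.continuous.continuousAt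
        ((hO.eventually_mem hw).mono fun w' hw' => Set.mem_image_of_mem _ hw')
    have hY : Tendsto (M.joint Y) (𝓝 w) (𝓝 (M.joint Y w)) := by
      rw [← hFO w hw]
      exact ((hF _ (Set.mem_image_of_mem _ hw)).tendsto.comp hjoint).congr'
        ((hO.eventually_mem hw).mono hFO)
    rw [← nhds_stateTopology]
    exact hY.le_comap
  · intro h
    obtain ⟨O, hOdep, hO, hs⟩ := mem_nhds_iff.1 h
    have : Nonempty M.State := ⟨s⟩
    let F (a : ∀ x : X, M.Rng x) : ∀ y : Y, M.Rng y := M.joint Y (Function.invFunOn (M.joint X) O a)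
    have hF : ∀ w ∈ O, F (M.joint X w) = M.joint Y w := fun w hw =>
      joint_eq_of_nhdsOn_le
        (hOdep (Function.invFunOn_mem ⟨w, hw, rfl⟩)) (Function.invFunOn_eq ⟨w, hw, rfl⟩)
    refine ⟨O, hO, hs, F, ?_, hF⟩
    rintro _ ⟨w, hw, rfl⟩
    have hY : Tendsto (M.joint Y) (𝓝 w) (𝓝 (M.joint Y w)) := by
      rw [nhds_stateTopology]
      exact tendsto_iff_comap.2 (hOdep hw)
    rw [ContinuousWithinAt, ← hX.map_nhdsWithin_eq, tendsto_map'_iff, hF w hw]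
    exact (hY.mono_left nhdsWithin_le_nhds).congr'
      (eventually_nhdsWithin_of_forall fun w' hw' => (hF w' hw').symm)

theorem sat_UDep {X Y : Finset Var} {s : M.State} :
    M.Sat (UDep X Y) s ↔ M.uniformityOn X ≤ M.uniformityOn Y := by
  rw [(M.uniformityOn_basis X).le_basis_iff (M.uniformityOn_basis Y)]
  simp only [Sat, Set.ofPred_subset_ofPred, Prod.forall]

theorem sat_imp {φ ψ : Formula Var ar} {s : M.State} :
    M.Sat (imp φ ψ) s ↔ (M.Sat φ s → M.Sat ψ s) := by
  simp [imp, Sat]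

/-- The concrete model on the image of the states among the assignments. -/
def toConcrete : ConcreteMetricModel Var ar where
  toTypedMetricModel := M.toTypedMetricModel
  States := Set.range fun s x => M.val x s
  range_eq x := by
    ext a
    obtain ⟨s, rfl⟩ := M.surj x a
    simp

/-- The assignment defined by a state, as a state of the concrete model. -/
def toAssignment (s : M.State) : M.toConcrete.toMetricModel.State :=
  ⟨fun x => M.val x s, s, rfl⟩

theorem toAssignment_surjective : Function.Surjective M.toAssignment := by
  rintro ⟨_, s, rfl⟩
  exact ⟨s, rfl⟩

theorem comap_toAssignment_nhdsOn (X : Finset Var) (s : M.State) :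
    comap M.toAssignment (M.toConcrete.toMetricModel.nhdsOn X (M.toAssignment s)) =
      M.nhdsOn X s := by
  rw [nhdsOn, nhdsOn, comap_comap]
  rfl

theorem comap_toAssignment_uniformityOn (X : Finset Var) :
    comap (Prod.map M.toAssignment M.toAssignment) (M.toConcrete.toMetricModel.uniformityOn X) =
      M.uniformityOn X := by
  rw [uniformityOn, uniformityOn, comap_comap, Prod.map_comp_map]
  rfl

theorem eventually_toAssignment {X : Finset Var} {s : M.State}
    {p : M.toConcrete.toMetricModel.State → Prop} :
    (∀ᶠ w in M.toConcrete.toMetricModel.nhdsOn X (M.toAssignment s), p w) ↔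
      ∀ᶠ w in M.nhdsOn X s, p (M.toAssignment w) := by
  rw [← comap_toAssignment_nhdsOn M, ← eventually_map (m := M.toAssignment),
    map_comap_of_surjective M.toAssignment_surjective]

theorem sat_toAssignment (φ : Formula Var ar) (s : M.State) :
    M.toConcrete.toMetricModel.Sat φ (M.toAssignment s) ↔ M.Sat φ s := by
  have hsurj := M.toAssignment_surjective
  induction φ generalizing s with
  | pred P xs => rfl
  | neg φ ih => exact not_congr (ih s)
  | and φ ψ ih₁ ih₂ => exact and_congr (ih₁ s) (ih₂ s)
  | D X φ ih => exact hsurj.forall.trans (forall_congr' fun w => imp_congr Iff.rfl (ih w))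
  | Dep X Y => exact hsurj.forall
  | K X φ ih => simp only [sat_K, eventually_toAssignment, ih]
  | KDep X Y =>
    rw [sat_KDep, sat_KDep, eventually_toAssignment]
    refine eventually_congr (.of_forall fun w => ?_)
    rw [← comap_toAssignment_nhdsOn M, ← comap_toAssignment_nhdsOn M,
      comap_le_comap_iff (by simp [hsurj.range_eq])]
  | UDep X Y =>
    rw [sat_UDep, sat_UDep, ← comap_toAssignment_uniformityOn M,
      ← comap_toAssignment_uniformityOn M,
      comap_le_comap_iff (by simp [(hsurj.prodMap hsurj).range_eq])]

theorem sat_D_pred [DecidableEq Var] {P : Pred} {xs : Fin (ar P) → Var} {s : M.State}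
    (h : M.Sat (pred P xs) s) : M.Sat (D (Finset.univ.image xs) (pred P xs)) s := by
  intro w hw
  have hval (i : Fin (ar P)) : M.val (xs i) s = M.val (xs i) w :=
    M.joint_eq_iff.1 hw _ (Finset.mem_image_of_mem xs (Finset.mem_univ i))
  simpa only [Sat, hval] using h

theorem sat_K_mp {X : Finset Var} {φ ψ : Formula Var ar} {s : M.State}
    (h : M.Sat (K X (imp φ ψ)) s) (hφ : M.Sat (K X φ) s) : M.Sat (K X ψ) s := by
  rw [sat_K] at h hφ ⊢
  exact hφ.mp (h.mono fun _ => M.sat_imp.1)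

theorem sat_K_K {X : Finset Var} {φ : Formula Var ar} {s : M.State} (h : M.Sat (K X φ) s) :
    M.Sat (K X (K X φ)) s := by
  simpa only [sat_K, eventually_eventually_nhdsOn] using h

theorem nhdsOn_le_of_sat_KDep {X Y : Finset Var} {s : M.State} (h : M.Sat (KDep X Y) s) :
    M.nhdsOn X s ≤ M.nhdsOn Y s :=
  eventually_nhdsOn_self (M.sat_KDep.1 h)

theorem sat_KDep_union [DecidableEq Var] {X Y Z : Finset Var} {s : M.State}
    (hY : M.Sat (KDep X Y) s) (hZ : M.Sat (KDep X Z) s) : M.Sat (KDep X (Y ∪ Z)) s := by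
  rw [sat_KDep] at hY hZ ⊢
  filter_upwards [hY, hZ] with w hwY hwZ
  rw [nhdsOn_union]
  exact le_inf hwY hwZ

theorem sat_KDep_trans {X Y Z : Finset Var} {s : M.State}
    (hXY : M.Sat (KDep X Y) s) (hYZ : M.Sat (KDep Y Z) s) : M.Sat (KDep X Z) s := by
  have hle := M.nhdsOn_le_of_sat_KDep hXY
  rw [sat_KDep] at hXY hYZ ⊢
  filter_upwards [hXY, hle hYZ] with w hw hw'
  exact hw.trans hw'

theorem sat_K_KDep {X Y : Finset Var} {s : M.State} (h : M.Sat (KDep X Y) s) :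
    M.Sat (K X (KDep X Y)) s := by
  simpa only [sat_K, sat_KDep, eventually_eventually_nhdsOn] using h

theorem sat_UDep_union [DecidableEq Var] {X Y Z : Finset Var} {s : M.State}
    (hY : M.Sat (UDep X Y) s) (hZ : M.Sat (UDep X Z) s) : M.Sat (UDep X (Y ∪ Z)) s := by
  rw [sat_UDep] at hY hZ ⊢
  rw [uniformityOn_union]
  exact le_inf hY hZ

theorem joint_empty (s t : M.State) : M.joint ∅ s = M.joint ∅ t :=
  Subsingleton.elim _ _

theorem sat_UDep_of_sat_Dep_empty {X Y : Finset Var} {s : M.State} (h : M.Sat (Dep ∅ Y) s) :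
    M.Sat (UDep X Y) s := by
  have hconst (t : M.State) : M.joint Y s = M.joint Y t := h t (M.joint_empty s t)
  rw [sat_UDep, M.uniformityOn_eq_top fun t t' => (hconst t).symm.trans (hconst t')]
  exact le_top

theorem sat_KDep_of_sat_UDep {X Y : Finset Var} {s t : M.State} (h : M.Sat (UDep X Y) t) :
    M.Sat (KDep X Y) s := by
  rw [sat_UDep] at h
  refine M.sat_KDep.2 (.of_forall fun w => ?_)
  simpa only [nhdsOn_eq_comap_uniformityOn] using comap_mono h

theorem sat_Dep_of_sat_KDep {X Y : Finset Var} {s : M.State} (h : M.Sat (KDep X Y) s) :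
    M.Sat (Dep X Y) s :=
  fun _ => joint_eq_of_nhdsOn_le (M.nhdsOn_le_of_sat_KDep h)

variable {M} in
theorem valid_imp {φ ψ : Formula Var ar} (h : ∀ s, M.Sat φ s → M.Sat ψ s) : M.Valid (imp φ ψ) :=
  fun s => M.sat_imp.2 (h s)

variable {M} in
theorem valid_imp_imp {φ ψ χ : Formula Var ar} (h : ∀ s, M.Sat φ s → M.Sat ψ s → M.Sat χ s) :
    M.Valid (imp φ (imp ψ χ)) :=
  valid_imp fun s hφ => M.sat_imp.2 (h s hφ)

theorem valid_of_provable [DecidableEq Var] {φ : Formula Var ar} (h : Provable φ) : M.Valid φ := by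
  induction h with
  | taut _ h => exact fun s => h (M.Sat · s) (fun _ => Iff.rfl) (fun _ _ => Iff.rfl)
  | modusPonens _ _ _ _ ih₁ ih₂ => exact fun s => M.sat_imp.1 (ih₁ s) (ih₂ s)
  | dNec _ _ _ ih => exact fun _ w _ => ih w
  | dDist => exact valid_imp_imp fun _ h h' w hw => M.sat_imp.1 (h w hw) (h' w hw)
  | dFactivity => exact valid_imp fun s h => h s rfl
  | dFour => exact valid_imp fun _ h _ hw w' hw' => h w' (hw.trans hw')
  | dFive => exact valid_imp fun _ h _ hw h' => h fun w' hw' => h' w' (hw.symm.trans hw')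
  | inclusion _ _ h => exact fun _ _ hw => M.joint_eq_of_subset h hw
  | additivity => exact valid_imp fun _ h w hw => M.joint_union_eq (h.1 w hw) (h.2 w hw)
  | transitivity => exact valid_imp fun _ h w hw => h.2 w (h.1 w hw)
  | determinedDep =>
    exact valid_imp fun _ h w hw w' hw' => (h w hw).symm.trans (h w' (hw.trans hw'))
  | transfer => exact valid_imp_imp fun _ h h' w hw => h' w (h w hw)
  | determinedAtoms => exact valid_imp fun _ => M.sat_D_pred
  | kNec _ _ _ ih => exact fun _ => M.sat_K.2 (.of_forall ih)
  | kDist => exact valid_imp_imp fun _ => M.sat_K_mp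
  | veracity => exact valid_imp fun _ h => eventually_nhdsOn_self (M.sat_K.1 h)
  | posIntrospection => exact valid_imp fun _ => M.sat_K_K
  | kInclusion _ _ h => exact fun _ => M.sat_KDep.2 (.of_forall (M.nhdsOn_anti h))
  | kAdditivity => exact valid_imp fun _ h => M.sat_KDep_union h.1 h.2
  | kTransitivity => exact valid_imp fun _ h => M.sat_KDep_trans h.1 h.2
  | knowabilityOfDep => exact valid_imp fun _ => M.sat_K_KDep
  | kTransfer =>
    exact valid_imp_imp fun _ h h' => M.sat_K.2 (M.nhdsOn_le_of_sat_KDep h (M.sat_K.1 h'))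
  | knowableDetermination =>
    exact valid_imp fun _ h _ hw => eventually_nhdsOn_self (nhdsOn_congr hw ▸ M.sat_K.1 h)
  | knowableDependence => exact valid_imp fun _ => M.sat_Dep_of_sat_KDep
  | knowledgeOfNecessity =>
    exact valid_imp fun s h => M.sat_K.2 (.of_forall fun w => h w (M.joint_empty s w))
  | knowledgeOfConstants =>
    exact valid_imp fun _ h => M.sat_KDep_of_sat_UDep (M.sat_UDep_of_sat_Dep_empty h)
  | uInclusion _ _ h => exact fun _ => M.sat_UDep.2 (M.uniformityOn_anti h)
  | uAdditivity => exact valid_imp fun _ h => M.sat_UDep_union h.1 h.2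
  | uTransitivity =>
    exact valid_imp fun _ h => M.sat_UDep.2 ((M.sat_UDep.1 h.1).trans (M.sat_UDep.1 h.2))
  | uKnown => exact valid_imp fun _ h => M.sat_K.2 (.of_forall fun _ => h)
  | uContinuity =>
    exact valid_imp fun _ h => M.sat_K.2 (.of_forall fun _ => M.sat_KDep_of_sat_UDep h)
  | uKnowledge =>
    exact valid_imp fun _ h => M.sat_UDep_of_sat_Dep_empty (M.sat_Dep_of_sat_KDep h)

end MetricModel

/-! ### Quasi-models -/

section QuasiModel

variable {Var Pred : Type u} {ar : Pred → ℕ}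

/-- The types `s` and `t` agree on the formulas whose truth value is determined by `Z`. -/
structure Agree (V : Finset Var) (Φ : Set (Formula Var ar)) (Z : Finset Var)
    (s t : Set (Formula Var ar)) : Prop where
  dep : ∀ Y ⊆ V, Dep Z Y ∈ s ↔ Dep Z Y ∈ t
  kdep : ∀ Y ⊆ V, KDep Z Y ∈ s ↔ KDep Z Y ∈ t
  d : ∀ ψ, D Z ψ ∈ Φ → (D Z ψ ∈ s ↔ D Z ψ ∈ t)
  k : ∀ ψ, K Z ψ ∈ Φ → (K Z ψ ∈ s ↔ K Z ψ ∈ t)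
  pred : ∀ P xs, pred P xs ∈ Φ → (∀ i, xs i ∈ Z) → (pred P xs ∈ s ↔ pred P xs ∈ t)

/-- The type `t` inherits from `s` the formulas that are stable under small changes of `Z`. -/
structure Inherit (V : Finset Var) (Φ : Set (Formula Var ar)) (Z : Finset Var)
    (s t : Set (Formula Var ar)) : Prop where
  kdep : ∀ Y ⊆ V, KDep Z Y ∈ s → KDep Z Y ∈ t
  k : ∀ ψ, K Z ψ ∈ Φ → K Z ψ ∈ s → K Z ψ ∈ t

/-- The accessibility relation for `D_X`. -/
def DRel (V : Finset Var) (Φ : Set (Formula Var ar)) (X : Finset Var)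
    (s t : Set (Formula Var ar)) : Prop :=
  ∀ Z ⊆ V, Dep X Z ∈ s → Agree V Φ Z s t

/-- The accessibility relation for `K_X`. -/
def KRel (V : Finset Var) (Φ : Set (Formula Var ar)) (X : Finset Var)
    (s t : Set (Formula Var ar)) : Prop :=
  ∀ Z ⊆ V, KDep X Z ∈ s → Inherit V Φ Z s t

/-- A relation of dependence between sets of variables: it is determined by a closure operator. -/
structure DepLike (V : Finset Var) (R : Finset Var → Finset Var → Prop) : Prop where
  iff_forall : ∀ X ⊆ V, ∀ Y ⊆ V, R X Y ↔ ∀ y ∈ Y, R X {y}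
  refl : ∀ X ⊆ V, ∀ x ∈ X, R X {x}
  trans : ∀ X ⊆ V, ∀ Y ⊆ V, ∀ Z ⊆ V, R X Y → R Y Z → R X Z

/-- A set `Φ` of formulas over the variables `V` that is closed under subformulas. -/
structure SubClosed (V : Finset Var) (Φ : Set (Formula Var ar)) : Prop where
  pred : ∀ P xs, pred P xs ∈ Φ → ∀ i, xs i ∈ V
  neg : ∀ ψ, neg ψ ∈ Φ → ψ ∈ Φ
  and : ∀ ψ χ, Formula.and ψ χ ∈ Φ → ψ ∈ Φ ∧ χ ∈ Φ
  d : ∀ X ψ, D X ψ ∈ Φ → X ⊆ V ∧ ψ ∈ Φ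
  dep : ∀ X Y, Dep X Y ∈ Φ → X ⊆ V ∧ Y ⊆ V
  k : ∀ X ψ, K X ψ ∈ Φ → X ⊆ V ∧ ψ ∈ Φ
  kdep : ∀ X Y, KDep X Y ∈ Φ → X ⊆ V ∧ Y ⊆ V
  udep : ∀ X Y, UDep X Y ∈ Φ → X ⊆ V ∧ Y ⊆ V

/-- A set `s` of formulas that respects the local axioms on `Φ` and on the dependence atoms
over `V`. -/
structure IsType (V : Finset Var) (Φ : Set (Formula Var ar)) (s : Set (Formula Var ar)) :
    Prop where
  neg : ∀ ψ, neg ψ ∈ Φ → (neg ψ ∈ s ↔ ψ ∉ s)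
  and : ∀ ψ χ, Formula.and ψ χ ∈ Φ → (Formula.and ψ χ ∈ s ↔ ψ ∈ s ∧ χ ∈ s)
  d : ∀ X ψ, D X ψ ∈ Φ → D X ψ ∈ s → ψ ∈ s
  k : ∀ X ψ, K X ψ ∈ Φ → K X ψ ∈ s → ψ ∈ s
  depLike : DepLike V fun X Y => Dep X Y ∈ s
  kdepLike : DepLike V fun X Y => KDep X Y ∈ s
  udepLike : DepLike V fun X Y => UDep X Y ∈ s
  dep_of_kdep : ∀ X ⊆ V, ∀ Y ⊆ V, KDep X Y ∈ s → Dep X Y ∈ s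
  kdep_of_udep : ∀ X ⊆ V, ∀ Y ⊆ V, UDep X Y ∈ s → KDep X Y ∈ s
  udep_of_const : ∀ X ⊆ V, ∀ Y ⊆ V, Dep ∅ Y ∈ s → UDep X Y ∈ s

/-- A set of types in which every failure of `D_X ψ` or `K_X ψ` is witnessed, and which is
connected by the relation for `D_∅`. -/
structure QuasiModel (V : Finset Var) (Φ : Set (Formula Var ar))
    (W : Set (Set (Formula Var ar))) : Prop where
  subClosed : SubClosed V Φ
  isType : ∀ s ∈ W, IsType V Φ s
  d : ∀ s ∈ W, ∀ X ψ, D X ψ ∈ Φ → D X ψ ∉ s → ∃ t ∈ W, DRel V Φ X s t ∧ ψ ∉ t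
  k : ∀ s ∈ W, ∀ X ψ, K X ψ ∈ Φ → K X ψ ∉ s → ∃ t ∈ W, KRel V Φ X s t ∧ ψ ∉ t
  all : ∀ s ∈ W, ∀ t ∈ W, DRel V Φ ∅ s t
  udep : ∀ s ∈ W, ∀ t ∈ W, ∀ X ⊆ V, ∀ Y ⊆ V, UDep X Y ∈ s → UDep X Y ∈ t

end QuasiModel

/-! ### Subformulas -/

namespace Formula

variable {Var Pred : Type u} {ar : Pred → ℕ} {φ ψ : Formula Var ar}

/-- The variables of a formula. -/
def vars [DecidableEq Var] : Formula Var ar → Finset Var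
  | pred _ xs => Finset.univ.image xs
  | neg φ => φ.vars
  | and φ ψ => φ.vars ∪ ψ.vars
  | D X φ => X ∪ φ.vars
  | Dep X Y => X ∪ Y
  | K X φ => X ∪ φ.vars
  | KDep X Y => X ∪ Y
  | UDep X Y => X ∪ Y

/-- The set of subformulas of a formula. -/
def subformulas : Formula Var ar → Set (Formula Var ar)
  | pred P xs => {pred P xs}
  | neg φ => insert (neg φ) φ.subformulas
  | and φ ψ => insert (and φ ψ) (φ.subformulas ∪ ψ.subformulas)
  | D X φ => insert (D X φ) φ.subformulas
  | Dep X Y => {Dep X Y}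
  | K X φ => insert (K X φ) φ.subformulas
  | KDep X Y => {KDep X Y}
  | UDep X Y => {UDep X Y}

theorem self_mem_subformulas (φ : Formula Var ar) : φ ∈ φ.subformulas := by
  cases φ <;> simp [subformulas]

theorem subformulas_subset_of_mem (hψ : ψ ∈ φ.subformulas) :
    ψ.subformulas ⊆ φ.subformulas := by
  induction φ with
  | pred | Dep | KDep | UDep =>
    rw [Set.mem_singleton_iff.1 hψ]
  | neg φ ih | D _ φ ih | K _ φ ih =>
    obtain rfl | hψ := hψ
    · rfl
    · exact (ih hψ).trans (Set.subset_insert _ _)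
  | and φ₁ φ₂ ih₁ ih₂ =>
    obtain rfl | hψ | hψ := hψ
    · rfl
    · exact ((ih₁ hψ).trans Set.subset_union_left).trans (Set.subset_insert _ _)
    · exact ((ih₂ hψ).trans Set.subset_union_right).trans (Set.subset_insert _ _)

theorem vars_subset_of_mem_subformulas [DecidableEq Var] (hψ : ψ ∈ φ.subformulas) :
    ψ.vars ⊆ φ.vars := by
  induction φ with
  | pred | Dep | KDep | UDep => rw [Set.mem_singleton_iff.1 hψ]
  | neg φ ih =>
    obtain rfl | hψ := hψ
    · rfl
    · exact ih hψ
  | D _ φ ih | K _ φ ih =>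
    obtain rfl | hψ := hψ
    · rfl
    · exact (ih hψ).trans Finset.subset_union_right
  | and φ₁ φ₂ ih₁ ih₂ =>
    obtain rfl | hψ | hψ := hψ
    · rfl
    · exact (ih₁ hψ).trans Finset.subset_union_left
    · exact (ih₂ hψ).trans Finset.subset_union_right

theorem subClosed_subformulas [DecidableEq Var] (φ : Formula Var ar) :
    SubClosed φ.vars φ.subformulas where
  pred _ _ h i := vars_subset_of_mem_subformulas h (Finset.mem_image_of_mem _ (Finset.mem_univ i))
  neg ψ h := subformulas_subset_of_mem h (.inr ψ.self_mem_subformulas)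
  and ψ χ h := ⟨subformulas_subset_of_mem h (.inr (.inl ψ.self_mem_subformulas)),
    subformulas_subset_of_mem h (.inr (.inr χ.self_mem_subformulas))⟩
  d _ ψ h := ⟨Finset.union_subset_left (vars_subset_of_mem_subformulas h),
    subformulas_subset_of_mem h (.inr ψ.self_mem_subformulas)⟩
  dep _ _ h := Finset.union_subset_iff.1 (vars_subset_of_mem_subformulas h)
  k _ ψ h := ⟨Finset.union_subset_left (vars_subset_of_mem_subformulas h),
    subformulas_subset_of_mem h (.inr ψ.self_mem_subformulas)⟩
  kdep _ _ h := Finset.union_subset_iff.1 (vars_subset_of_mem_subformulas h)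
  udep _ _ h := Finset.union_subset_iff.1 (vars_subset_of_mem_subformulas h)

/-! ### Maximal theories -/

theorem isTautology_and_left : IsTautology (imp (and φ ψ) φ) := fun v hn ha => by
  simp only [imp, hn, ha]; tauto

theorem isTautology_and_right : IsTautology (imp (and φ ψ) ψ) := fun v hn ha => by
  simp only [imp, hn, ha]; tauto

theorem isTautology_and_intro : IsTautology (imp φ (imp ψ (and φ ψ))) := fun v hn ha => by
  simp only [imp, hn, ha]; tauto

theorem isTautology_imp_self : IsTautology (imp φ φ) := fun v hn ha => by
  simp only [imp, hn, ha]; tauto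

theorem isTautology_imp_left : IsTautology (imp ψ (imp φ ψ)) := fun v hn ha => by
  simp only [imp, hn, ha]; tauto

theorem isTautology_imp_distrib {χ : Formula Var ar} :
    IsTautology (imp (imp φ (imp ψ χ)) (imp (imp φ ψ) (imp φ χ))) := fun v hn ha => by
  simp only [imp, hn, ha]; tauto

theorem isTautology_neg_elim : IsTautology (imp (neg φ) (imp φ ψ)) := fun v hn ha => by
  simp only [imp, hn, ha]; tauto

theorem isTautology_cases :
    IsTautology (imp (imp φ ψ) (imp (imp (neg φ) ψ) ψ)) := fun v hn ha => by
  simp only [imp, hn, ha]; tauto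

end Formula

variable {Var Pred : Type u} [DecidableEq Var] {ar : Pred → ℕ}

theorem Provable.imp_trans {φ ψ χ : Formula Var ar} (h₁ : Provable (imp φ ψ))
    (h₂ : Provable (imp ψ χ)) : Provable (imp φ χ) :=
  .modusPonens _ _ (.modusPonens _ _ (.taut _ isTautology_imp_distrib)
    (.modusPonens _ _ (.taut _ isTautology_imp_left) h₂)) h₁

/-- A set of formulas that contains the theorems of **LUD** and is closed under modus ponens. -/
structure IsTheory (T : Set (Formula Var ar)) : Prop where
  provable : ∀ φ, Provable φ → φ ∈ T
  mp : ∀ φ ψ, imp φ ψ ∈ T → φ ∈ T → ψ ∈ T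

/-- A maximal consistent theory. -/
structure IsMaximal (T : Set (Formula Var ar)) : Prop extends IsTheory T where
  neg_mem_iff : ∀ φ, neg φ ∈ T ↔ φ ∉ T

namespace IsTheory

theorem setOf_provable : IsTheory {φ : Formula Var ar | Provable φ} := ⟨fun _ h => h, .modusPonens⟩

theorem sUnion_of_isChain {c : Set (Set (Formula Var ar))} (hc : ∀ T ∈ c, IsTheory T)
    (hchain : IsChain (· ⊆ ·) c) (hne : c.Nonempty) : IsTheory (⋃₀ c) where
  provable φ h := by
    obtain ⟨S, hS⟩ := hne
    exact ⟨S, hS, (hc S hS).provable φ h⟩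
  mp := by
    rintro φ ψ ⟨S, hS, hφψ⟩ ⟨T, hT, hφ⟩
    obtain h | h := hchain.total hS hT
    · exact ⟨T, hT, (hc T hT).mp _ _ (h hφψ) hφ⟩
    · exact ⟨S, hS, (hc S hS).mp _ _ hφψ (h hφ)⟩

variable {T : Set (Formula Var ar)} (hT : IsTheory T) {φ ψ : Formula Var ar}
include hT

theorem mp_provable (h : Provable (imp φ ψ)) (hφ : φ ∈ T) : ψ ∈ T :=
  hT.mp _ _ (hT.provable _ h) hφ

theorem mp_tautology (h : IsTautology (imp φ ψ)) (hφ : φ ∈ T) : ψ ∈ T :=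
  hT.mp_provable (.taut _ h) hφ

theorem and_mem_iff : and φ ψ ∈ T ↔ φ ∈ T ∧ ψ ∈ T :=
  ⟨fun h => ⟨hT.mp_tautology isTautology_and_left h, hT.mp_tautology isTautology_and_right h⟩,
    fun h => hT.mp _ _ (hT.mp_tautology isTautology_and_intro h.1) h.2⟩

theorem adjoin (φ : Formula Var ar) : IsTheory {ψ | imp φ ψ ∈ T} where
  provable ψ h := hT.mp_tautology isTautology_imp_left (hT.provable ψ h)
  mp _ _ h₁ h₂ := hT.mp _ _ (hT.mp_tautology isTautology_imp_distrib h₁) h₂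

omit hT in
theorem isMaximal_of_maximal (hT : Maximal (fun S => IsTheory S ∧ φ ∉ S) T) : IsMaximal T := by
  obtain ⟨hTheory, hφ⟩ := hT.prop
  have imp_mem (ψ) (hψ : ψ ∉ T) : imp ψ φ ∈ T := by
    by_contra hψφ
    exact hψ (hT.le_of_ge (y := {χ | imp ψ χ ∈ T}) ⟨hTheory.adjoin ψ, hψφ⟩
      (fun χ hχ => hTheory.mp_tautology isTautology_imp_left hχ)
      (hTheory.provable _ (.taut _ isTautology_imp_self)))
  refine ⟨hTheory, fun ψ => ⟨fun hnot hψ => hφ ?_, fun hψ => ?_⟩⟩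
  · exact hTheory.mp _ _ (hTheory.mp_tautology isTautology_neg_elim hnot) hψ
  · by_contra hnot
    exact hφ (hTheory.mp _ _ (hTheory.mp_tautology isTautology_cases (imp_mem _ hψ))
      (imp_mem _ hnot))

theorem exists_isMaximal (hφ : φ ∉ T) : ∃ T' ⊇ T, IsMaximal T' ∧ φ ∉ T' := by
  obtain ⟨T', hTT', hmax⟩ := zorn_subset_nonempty {S | IsTheory S ∧ φ ∉ S}
    (fun c hc hchain hne => ⟨⋃₀ c,
      ⟨sUnion_of_isChain (fun S hS => (hc hS).1) hchain hne, fun ⟨S, hS, h⟩ => (hc hS).2 h⟩,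
      fun S hS => Set.subset_sUnion_of_mem hS⟩) T ⟨hT, hφ⟩
  exact ⟨T', hTT', isMaximal_of_maximal hmax, hmax.prop.2⟩

theorem unboxD (X : Finset Var) : IsTheory {ψ | D X ψ ∈ T} where
  provable ψ h := hT.provable _ (.dNec X ψ h)
  mp ψ χ h₁ h₂ := hT.mp _ _ (hT.mp_provable (.dDist X ψ χ) h₁) h₂

theorem unboxK (X : Finset Var) : IsTheory {ψ | K X ψ ∈ T} where
  provable ψ h := hT.provable _ (.kNec X ψ h)
  mp ψ χ h₁ h₂ := hT.mp _ _ (hT.mp_provable (.kDist X ψ χ) h₁) h₂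

theorem depLike (V : Finset Var) (R : Finset Var → Finset Var → Formula Var ar)
    (inclusion : ∀ X Y, Y ⊆ X → Provable (R X Y))
    (additivity : ∀ X Y Z, Provable (imp (and (R X Y) (R X Z)) (R X (Y ∪ Z))))
    (transitivity : ∀ X Y Z, Provable (imp (and (R X Y) (R Y Z)) (R X Z))) :
    DepLike V fun X Y => R X Y ∈ T where
  iff_forall X _ Y _ := by
    have trans {Y Z} (h : R X Y ∈ T) (h' : R Y Z ∈ T) : R X Z ∈ T :=
      hT.mp_provable (transitivity X Y Z) (hT.and_mem_iff.2 ⟨h, h'⟩)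
    refine ⟨fun h y hy => trans h (hT.provable _ (inclusion _ _ (by simpa))), fun h => ?_⟩
    clear trans
    induction Y using Finset.induction_on with
    | empty => exact hT.provable _ (inclusion _ _ (Finset.empty_subset X))
    | insert y Y _ ih =>
      rw [Finset.insert_eq]
      exact hT.mp_provable (additivity X {y} Y) (hT.and_mem_iff.2
        ⟨h y (by simp), ih ((Finset.subset_insert _ _).trans ‹_›) fun z hz => h z (by simp [hz])⟩)
  refl X _ x hx := hT.provable _ (inclusion _ _ (by simpa))
  trans X _ Y _ Z _ h h' := hT.mp_provable (transitivity X Y Z) (hT.and_mem_iff.2 ⟨h, h'⟩)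

end IsTheory

/-- A formula is `Z`-determined if its truth provably implies that it is determined by `Z`. -/
def Determined (Z : Finset Var) (φ : Formula Var ar) : Prop := Provable (imp φ (D Z φ))

/-- A formula is `Z`-stable if its truth provably implies that it is knowable given `Z`. -/
def Stable (Z : Finset Var) (φ : Formula Var ar) : Prop := Provable (imp φ (K Z φ))

theorem Stable.determined {Z : Finset Var} {φ : Formula Var ar} (h : Stable Z φ) :
    Determined Z φ := h.imp_trans (.knowableDetermination Z φ)

theorem Determined.stable_empty {φ : Formula Var ar} (h : Determined ∅ φ) : Stable ∅ φ :=
  h.imp_trans (.knowledgeOfNecessity φ)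

namespace IsMaximal

variable {S T : Set (Formula Var ar)}

theorem mem_of_determined (hS : IsMaximal S) {X Z : Finset Var} (h : {χ | D X χ ∈ S} ⊆ T)
    (hXZ : Dep X Z ∈ S) {φ : Formula Var ar} (hφ : Determined Z φ) (hφS : φ ∈ S) : φ ∈ T :=
  h (hS.mp _ _ (hS.mp_provable (.transfer X Z φ) hXZ) (hS.mp_provable hφ hφS))

theorem mem_iff_of_determined (hS : IsMaximal S) (hT : IsMaximal T) {X Z : Finset Var}
    (h : {χ | D X χ ∈ S} ⊆ T) (hXZ : Dep X Z ∈ S) {φ : Formula Var ar} (hφ : Determined Z φ) :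
    φ ∈ S ↔ φ ∈ T := by
  refine ⟨hS.mem_of_determined h hXZ hφ, fun hφT => ?_⟩
  by_contra hφS
  have not_D_mem : neg (D Z φ) ∈ S :=
    (hS.neg_mem_iff _).2 fun h' => hφS (hS.mp_provable (.dFactivity Z φ) h')
  exact (hT.neg_mem_iff _).1 (hS.mem_of_determined h hXZ (.dFive Z φ) not_D_mem)
    (hT.mp_provable hφ hφT)

theorem mem_of_stable (hS : IsMaximal S) {X Z : Finset Var} (h : {χ | K X χ ∈ S} ⊆ T)
    (hXZ : KDep X Z ∈ S) {φ : Formula Var ar} (hφ : Stable Z φ) (hφS : φ ∈ S) : φ ∈ T :=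
  h (hS.mp _ _ (hS.mp_provable (.kTransfer X Z φ) hXZ) (hS.mp_provable hφ hφS))

theorem dRel (hS : IsMaximal S) (hT : IsMaximal T) (V : Finset Var) (Φ : Set (Formula Var ar))
    {X : Finset Var} (h : {χ | D X χ ∈ S} ⊆ T) : DRel V Φ X S T := by
  intro Z _ hXZ
  have mem_iff {φ} := hS.mem_iff_of_determined hT h hXZ (φ := φ)
  refine ⟨fun Y _ => mem_iff (.determinedDep Z Y),
    fun Y _ => mem_iff (Stable.determined (.knowabilityOfDep Z Y)), fun ψ _ => mem_iff (.dFour Z ψ),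
    fun ψ _ => mem_iff (Stable.determined (.posIntrospection Z ψ)), fun P xs _ hxs => ?_⟩
  have hZ : Dep Z (Finset.univ.image xs) ∈ S :=
    hS.provable _ (.inclusion _ _ (by simpa [Finset.image_subset_iff] using hxs))
  exact hS.mem_iff_of_determined hT h
    (hS.mp_provable (.transitivity X Z _) (hS.and_mem_iff.2 ⟨hXZ, hZ⟩)) (.determinedAtoms P xs)

theorem kRel (hS : IsMaximal S) (V : Finset Var) (Φ : Set (Formula Var ar))
    {X : Finset Var} (h : {χ | K X χ ∈ S} ⊆ T) : KRel V Φ X S T := fun Z _ hXZ =>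
  ⟨fun Y _ => hS.mem_of_stable h hXZ (.knowabilityOfDep Z Y),
    fun ψ _ => hS.mem_of_stable h hXZ (.posIntrospection Z ψ)⟩

theorem isType (hS : IsMaximal S) (V : Finset Var) (Φ : Set (Formula Var ar)) :
    IsType V Φ S where
  neg ψ _ := hS.neg_mem_iff ψ
  and _ _ _ := hS.and_mem_iff
  d X ψ _ := hS.mp_provable (.dFactivity X ψ)
  k X ψ _ := hS.mp_provable (.veracity X ψ)
  depLike := hS.depLike V Dep .inclusion .additivity .transitivity
  kdepLike := hS.depLike V KDep .kInclusion .kAdditivity .kTransitivity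
  udepLike := hS.depLike V UDep .uInclusion .uAdditivity .uTransitivity
  dep_of_kdep X _ Y _ := hS.mp_provable (.knowableDependence X Y)
  kdep_of_udep X _ Y _ h :=
    hS.mp_provable (.veracity ∅ _) (hS.mp_provable (.uContinuity X Y) h)
  udep_of_const X _ Y _ h :=
    hS.mp_provable (.uKnowledge X Y) (hS.mp_provable (.knowledgeOfConstants Y) h)

end IsMaximal

/-- The canonical quasi-model around the theory `S₀`: the maximal theories in which everything
that is necessary according to `S₀` is true. -/
def canonical (S₀ : Set (Formula Var ar)) : Set (Set (Formula Var ar)) :=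
  {S | IsMaximal S ∧ {χ | D ∅ χ ∈ S₀} ⊆ S}

section Canonical

variable {S₀ S T : Set (Formula Var ar)} (hS₀ : IsMaximal S₀)
include hS₀

theorem self_mem_canonical : S₀ ∈ canonical S₀ :=
  ⟨hS₀, fun χ h => hS₀.mp_provable (.dFactivity ∅ χ) h⟩

theorem all_mem_iff_of_mem_canonical (hS : S ∈ canonical S₀) {χ : Formula Var ar} :
    D ∅ χ ∈ S₀ ↔ D ∅ χ ∈ S :=
  hS₀.mem_iff_of_determined hS.1 hS.2 (hS₀.provable _ (.inclusion _ _ subset_rfl)) (.dFour ∅ χ)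

theorem mem_canonical_of_unboxD_subset (hS : S ∈ canonical S₀) (hT : IsMaximal T) {X : Finset Var}
    (hST : {χ | D X χ ∈ S} ⊆ T) : T ∈ canonical S₀ := by
  refine ⟨hT, fun χ hχ => hT.mp_provable (.dFactivity ∅ χ) ?_⟩
  exact hS.1.mem_of_determined hST (hS.1.provable _ (.inclusion _ _ X.empty_subset)) (.dFour ∅ χ)
    ((all_mem_iff_of_mem_canonical hS₀ hS).1 hχ)

theorem mem_canonical_of_unboxK_subset (hS : S ∈ canonical S₀) (hT : IsMaximal T) {X : Finset Var}
    (hST : {χ | K X χ ∈ S} ⊆ T) : T ∈ canonical S₀ := by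
  refine ⟨hT, fun χ hχ => hT.mp_provable (.dFactivity ∅ χ) ?_⟩
  exact hS.1.mem_of_stable hST (hS.1.provable _ (.kInclusion _ _ X.empty_subset))
    (Determined.stable_empty (.dFour ∅ χ)) ((all_mem_iff_of_mem_canonical hS₀ hS).1 hχ)

theorem unboxD_empty_subset (hS : S ∈ canonical S₀) (hT : T ∈ canonical S₀) :
    {χ | D ∅ χ ∈ S} ⊆ T :=
  fun _ hχ => hT.2 ((all_mem_iff_of_mem_canonical hS₀ hS).2 hχ)

theorem quasiModel_canonical {V : Finset Var} {Φ : Set (Formula Var ar)} (hΦ : SubClosed V Φ) :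
    QuasiModel V Φ (canonical S₀) where
  subClosed := hΦ
  isType S hS := hS.1.isType V Φ
  d S hS X ψ _ hψ := by
    obtain ⟨T, hST, hT, hψT⟩ := (hS.1.unboxD X).exists_isMaximal hψ
    exact ⟨T, mem_canonical_of_unboxD_subset hS₀ hS hT hST, hS.1.dRel hT V Φ hST, hψT⟩
  k S hS X ψ _ hψ := by
    obtain ⟨T, hST, hT, hψT⟩ := (hS.1.unboxK X).exists_isMaximal hψ
    exact ⟨T, mem_canonical_of_unboxK_subset hS₀ hS hT hST, hS.1.kRel V Φ hST, hψT⟩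
  all S hS T hT := hS.1.dRel hT.1 V Φ (unboxD_empty_subset hS₀ hS hT)
  udep S hS T hT X _ Y _ :=
    hS.1.mem_of_determined (unboxD_empty_subset hS₀ hS hT)
      (hS.1.provable _ (.inclusion _ _ subset_rfl)) (Stable.determined (.uKnown X Y))

end Canonical

theorem exists_quasiModel_of_not_provable {φ : Formula Var ar} (hφ : ¬ Provable φ) :
    ∃ W, QuasiModel φ.vars φ.subformulas W ∧ ∃ s ∈ W, φ ∉ s := by
  obtain ⟨S₀, -, hS₀, hφS₀⟩ := IsTheory.setOf_provable.exists_isMaximal hφ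
  exact ⟨canonical S₀, quasiModel_canonical hS₀ φ.subClosed_subformulas, S₀,
    self_mem_canonical hS₀, hφS₀⟩

/-! ### Ultrametric trees -/

section TreeDist

variable {P L R : Type*} [LinearOrder R] [OrderBot R] (w : P → L × P → R)

/-- The largest weight of an edge of a path that starts at `p`. A path is the list of its edges,
each given by its label and its endpoint. -/
def height : P → List (L × P) → R
  | _, [] => ⊥
  | p, e :: l => max (w p e) (height e.2 l)

/-- The endpoint of a path that starts at `p`. -/
def endpt : P → List (L × P) → P
  | p, [] => p
  | _, e :: l => endpt e.2 l

open Classical in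
/-- The largest weight of an edge on the way from one path to another, where the paths start at
`p` and are regarded as nodes of the tree of all paths. -/
noncomputable def treeDist : P → List (L × P) → List (L × P) → R
  | p, [], l => height w p l
  | p, e :: l, [] => height w p (e :: l)
  | p, e :: l, e' :: l' =>
    if e = e' then treeDist e.2 l l' else max (height w p (e :: l)) (height w p (e' :: l'))

@[simp] theorem endpt_nil (p : P) : endpt p ([] : List (L × P)) = p := rfl

@[simp] theorem endpt_cons (p : P) (e : L × P) (l : List (L × P)) :
    endpt p (e :: l) = endpt e.2 l := rfl

@[simp] theorem endpt_append (p : P) (l l' : List (L × P)) :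
    endpt p (l ++ l') = endpt (endpt p l) l' := by
  induction l generalizing p with
  | nil => rfl
  | cons e _ ih => exact ih _

@[simp] theorem height_nil (p : P) : height w p [] = ⊥ := rfl

theorem height_cons (p : P) (e : L × P) (l : List (L × P)) :
    height w p (e :: l) = max (w p e) (height w e.2 l) := rfl

@[simp] theorem treeDist_nil_left (p : P) (l : List (L × P)) :
    treeDist w p [] l = height w p l := by
  rw [treeDist]

@[simp] theorem treeDist_nil_right (p : P) (l : List (L × P)) :
    treeDist w p l [] = height w p l := by
  cases l <;> rw [treeDist]

@[simp] theorem treeDist_cons_cons_self (p : P) (e : L × P) (l l' : List (L × P)) :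
    treeDist w p (e :: l) (e :: l') = treeDist w e.2 l l' := by
  rw [treeDist, if_pos rfl]

theorem treeDist_cons_cons_of_ne (p : P) {e e' : L × P} (h : e ≠ e') (l l' : List (L × P)) :
    treeDist w p (e :: l) (e' :: l') = max (height w p (e :: l)) (height w p (e' :: l')) := by
  rw [treeDist, if_neg h]

variable (R) in
theorem exists_append_treeDist_eq (p : P) (l l' : List (L × P)) :
    ∃ c a b, l = c ++ a ∧ l' = c ++ b ∧ ∀ w : P → L × P → R,
      treeDist w p l l' = max (height w (endpt p c) a) (height w (endpt p c) b) := by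
  induction l generalizing p l' with
  | nil => exact ⟨[], [], l', rfl, rfl, fun w => by simp⟩
  | cons e l ih =>
    cases l' with
    | nil => exact ⟨[], e :: l, [], rfl, rfl, fun w => by simp⟩
    | cons e' l' =>
      obtain rfl | h := eq_or_ne e e'
      · obtain ⟨c, a, b, rfl, rfl, h⟩ := ih e.2 l'
        exact ⟨e :: c, a, b, rfl, rfl, fun w => by simp [h w]⟩
      · exact ⟨[], e :: l, e' :: l', rfl, rfl, fun w => treeDist_cons_cons_of_ne w p h l l'⟩

theorem treeDist_comm (p : P) (l l' : List (L × P)) :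
    treeDist w p l l' = treeDist w p l' l := by
  induction l generalizing p l' with
  | nil => simp
  | cons e l ih =>
    cases l' with
    | nil => simp
    | cons e' l' =>
      obtain rfl | h := eq_or_ne e e'
      · simpa using ih _ _
      · rw [treeDist_cons_cons_of_ne w p h, treeDist_cons_cons_of_ne w p h.symm, max_comm]

@[simp] theorem treeDist_self (p : P) (l : List (L × P)) : treeDist w p l l = ⊥ := by
  induction l generalizing p with
  | nil => simp
  | cons e l ih => simpa using ih _

theorem treeDist_append_singleton (p : P) (l : List (L × P)) (e : L × P) :
    treeDist w p l (l ++ [e]) = w (endpt p l) e := by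
  induction l generalizing p with
  | nil => simp [height_cons]
  | cons e' l ih => simpa using ih _

theorem treeDist_le_max_height (p : P) (l l' : List (L × P)) :
    treeDist w p l l' ≤ max (height w p l) (height w p l') := by
  induction l generalizing p l' with
  | nil => simp
  | cons e l ih =>
    cases l' with
    | nil => simp
    | cons e' l' =>
      obtain rfl | h := eq_or_ne e e'
      · rw [treeDist_cons_cons_self]
        exact (ih _ _).trans (max_le_max (le_max_right _ _) (le_max_right _ _))
      · rw [treeDist_cons_cons_of_ne w p h]

theorem height_le_max_treeDist (p : P) (l l' : List (L × P)) :
    height w p l ≤ max (height w p l') (treeDist w p l l') := by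
  induction l generalizing p l' with
  | nil => simp
  | cons e l ih =>
    cases l' with
    | nil => simp
    | cons e' l' =>
      obtain rfl | h := eq_or_ne e e'
      · rw [treeDist_cons_cons_self, height_cons, height_cons]
        refine max_le ((le_max_left _ _).trans (le_max_left _ _)) ((ih _ l').trans ?_)
        exact max_le_max (le_max_right _ _) le_rfl
      · rw [treeDist_cons_cons_of_ne w p h]
        exact (le_max_left _ _).trans (le_max_right _ _)

variable {w}

theorem treeDist_le_max_of_treeDist_eq_max_height {p : P} {l₁ l₂ l₃ : List (L × P)}
    (h : treeDist w p l₂ l₃ = max (height w p l₂) (height w p l₃)) :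
    treeDist w p l₁ l₃ ≤ max (treeDist w p l₁ l₂) (treeDist w p l₂ l₃) := by
  refine (treeDist_le_max_height w p l₁ l₃).trans (max_le ?_ ?_)
  · refine (height_le_max_treeDist w p l₁ l₂).trans (max_le ?_ (le_max_left _ _))
    exact (h.symm ▸ le_max_left _ _ : height w p l₂ ≤ _).trans (le_max_right _ _)
  · exact (h.symm ▸ le_max_right _ _ : height w p l₃ ≤ _).trans (le_max_right _ _)

theorem treeDist_le_max_of_treeDist_eq_max_height' {p : P} {l₁ l₂ l₃ : List (L × P)}
    (h : treeDist w p l₁ l₂ = max (height w p l₁) (height w p l₂)) :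
    treeDist w p l₁ l₃ ≤ max (treeDist w p l₁ l₂) (treeDist w p l₂ l₃) := by
  rw [treeDist_comm w p l₁ l₃, treeDist_comm w p l₁ l₂, treeDist_comm w p l₂ l₃, max_comm]
  exact treeDist_le_max_of_treeDist_eq_max_height (by rw [treeDist_comm, h, max_comm])

variable (w)

theorem treeDist_le_max (p : P) (l₁ l₂ l₃ : List (L × P)) :
    treeDist w p l₁ l₃ ≤ max (treeDist w p l₁ l₂) (treeDist w p l₂ l₃) := by
  induction l₂ generalizing p l₁ l₃ with
  | nil => exact treeDist_le_max_of_treeDist_eq_max_height (by simp)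
  | cons e₂ l₂ ih =>
    cases l₁ with
    | nil => exact treeDist_le_max_of_treeDist_eq_max_height' (by simp)
    | cons e₁ l₁ =>
      cases l₃ with
      | nil => exact treeDist_le_max_of_treeDist_eq_max_height (by simp)
      | cons e₃ l₃ =>
        obtain rfl | h₁₂ := eq_or_ne e₁ e₂
        · obtain rfl | h₂₃ := eq_or_ne e₁ e₃
          · simpa using ih _ _ _
          · exact treeDist_le_max_of_treeDist_eq_max_height (treeDist_cons_cons_of_ne w p h₂₃ _ _)
        · exact treeDist_le_max_of_treeDist_eq_max_height' (treeDist_cons_cons_of_ne w p h₁₂ _ _)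

theorem height_cons_eq_zero {w : P → L × P → ℝ≥0} {p : P} {e : L × P} {l : List (L × P)} :
    height w p (e :: l) = 0 ↔ w p e = 0 ∧ height w e.2 l = 0 :=
  max_eq_bot

end TreeDist

/-! ### Edge weights over a quasi-model -/

/-- The labels of the edges of the tree: `det X` for a change that keeps `X` fixed, and `know X n`
for a change of `X` by about `1 / (n + 1)`. -/
inductive Label (Var : Type u) : Type u
  | det (X : Finset Var) : Label Var
  | know (X : Finset Var) (n : ℕ) : Label Var

variable {Var Pred : Type u} {ar : Pred → ℕ}

/-- The variables that are made constant in the model over a quasi-model: those that are constant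
according to its types, and those that its formulas do not mention. -/
def ConstVar (V : Finset Var) (W : Set (Set (Formula Var ar))) (x : Var) : Prop :=
  x ∉ V ∨ ∀ s ∈ W, Dep ∅ {x} ∈ s

/-- A node of the tree: a type, and a number that bounds the local Lipschitz constants. -/
abbrev Node (W : Set (Set (Formula Var ar))) : Type u := W × ℕ

open Classical in
/-- The amount by which the variable `x` changes along an edge. Edges that change the number of the
node, or that do not respect the relation of their label, are jumps: all variables that are not
constant change by `1`. -/
noncomputable def weight (V : Finset Var) (Φ : Set (Formula Var ar))
    (W : Set (Set (Formula Var ar))) (x : Var) (p : Node W) (e : Label Var × Node W) : ℝ≥0 :=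
  if ConstVar V W x then 0
  else if e.2.2 ≠ p.2 then 1
  else match e.1 with
    | .det X => if (X ⊆ V ∧ DRel V Φ X p.1 e.2.1) ∧ Dep X {x} ∈ p.1.1 then 0 else 1
    | .know X n =>
      if X ⊆ V ∧ KRel V Φ X p.1 e.2.1 then
        if UDep X {x} ∈ p.1.1 then (n + 1 : ℝ≥0)⁻¹
        else if KDep X {x} ∈ p.1.1 then min 1 ((p.2 + 1) * (n + 1 : ℝ≥0)⁻¹) else 1
      else 1

section Weight

variable {V : Finset Var} {Φ : Set (Formula Var ar)} {W : Set (Set (Formula Var ar))}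
  {X Y Z : Finset Var} {x y : Var} {n : ℕ} {p : Node W} {t : W}

theorem weight_of_constVar (hx : ConstVar V W x) (p : Node W) (e : Label Var × Node W) :
    weight V Φ W x p e = 0 := if_pos hx

theorem inv_natCast_add_one_le_min (N n : ℕ) :
    (n + 1 : ℝ≥0)⁻¹ ≤ min 1 ((N + 1) * (n + 1 : ℝ≥0)⁻¹) :=
  le_min (inv_le_one_of_one_le₀ le_add_self) (le_mul_of_one_le_left zero_le le_add_self)

theorem exists_rel_of_weight_lt_one {e : Label Var × Node W} (hx : ¬ ConstVar V W x)
    (h : weight V Φ W x p e < 1) :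
    (∃ X ⊆ V, ∃ t : W, DRel V Φ X p.1 t ∧ e = (Label.det X, t, p.2)) ∨
      ∃ X ⊆ V, ∃ n, ∃ t : W, KRel V Φ X p.1 t ∧ e = (Label.know X n, t, p.2) := by
  obtain ⟨l, t, N⟩ := e
  simp only [weight, if_neg hx] at h
  obtain rfl : N = p.2 := by by_contra hN; simp [hN] at h
  cases l with
  | det X =>
    obtain ⟨hX, hR⟩ : X ⊆ V ∧ DRel V Φ X p.1 t := by by_contra hR; simp [hR] at h
    exact .inl ⟨X, hX, t, hR, rfl⟩
  | know X n =>
    obtain ⟨hX, hR⟩ : X ⊆ V ∧ KRel V Φ X p.1 t := by by_contra hR; simp [hR] at h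
    exact .inr ⟨X, hX, n, t, hR, rfl⟩

theorem dep_of_weight_det_lt_one {q : Node W} (hx : ¬ ConstVar V W x)
    (h : weight V Φ W x p (.det X, q) < 1) : Dep X {x} ∈ p.1.1 := by
  by_contra hd
  simp [weight, hx, hd] at h

theorem weight_det_of_dep (hX : X ⊆ V) (hR : DRel V Φ X p.1 t) (hx : Dep X {x} ∈ p.1.1) :
    weight V Φ W x p (.det X, t, p.2) = 0 := by
  simp [weight, hX, hR, hx]

theorem udep_or_kdep_of_weight_know_lt_one {q : Node W} (hx : ¬ ConstVar V W x)
    (h : weight V Φ W x p (.know X n, q) < 1) : UDep X {x} ∈ p.1.1 ∨ KDep X {x} ∈ p.1.1 := by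
  by_contra! hd
  simp [weight, hx, hd] at h

theorem inv_le_weight_know (hx : ¬ ConstVar V W x) (q : Node W) :
    (n + 1 : ℝ≥0)⁻¹ ≤ weight V Φ W x p (.know X n, q) := by
  have hmin := inv_natCast_add_one_le_min p.2 n
  simp only [weight, if_neg hx]
  split_ifs <;> first | exact hmin | exact le_rfl | exact hmin.trans (min_le_left _ _)

theorem weight_know_le_of_udep (hX : X ⊆ V) (hR : KRel V Φ X p.1 t) (hx : UDep X {x} ∈ p.1.1) :
    weight V Φ W x p (.know X n, t, p.2) ≤ (n + 1 : ℝ≥0)⁻¹ := by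
  by_cases hc : ConstVar V W x <;> simp [weight, hX, hR, hx, hc]

theorem weight_know_le_of_kdep (hX : X ⊆ V) (hR : KRel V Φ X p.1 t) (hx : KDep X {x} ∈ p.1.1) :
    weight V Φ W x p (.know X n, t, p.2) ≤ min 1 ((p.2 + 1) * (n + 1 : ℝ≥0)⁻¹) := by
  by_cases hu : UDep X {x} ∈ p.1.1
  · exact (weight_know_le_of_udep hX hR hu).trans (inv_natCast_add_one_le_min p.2 n)
  · by_cases hc : ConstVar V W x <;> simp [weight, hX, hR, hx, hc, hu]

theorem min_le_weight_know (hc : ¬ ConstVar V W x) (hx : UDep X {x} ∉ p.1.1) (q : Node W) :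
    min 1 ((p.2 + 1) * (n + 1 : ℝ≥0)⁻¹) ≤ weight V Φ W x p (.know X n, q) := by
  simp only [weight, if_neg hc, if_neg hx]
  split_ifs <;> first | exact le_rfl | exact min_le_left _ _

theorem Agree.refl (s : Set (Formula Var ar)) : Agree V Φ Z s s :=
  ⟨fun _ _ => Iff.rfl, fun _ _ => Iff.rfl, fun _ _ => Iff.rfl, fun _ _ => Iff.rfl,
    fun _ _ _ _ => Iff.rfl⟩

theorem Agree.symm {s t : Set (Formula Var ar)} (h : Agree V Φ Z s t) : Agree V Φ Z t s :=
  ⟨fun Y hY => (h.dep Y hY).symm, fun Y hY => (h.kdep Y hY).symm, fun ψ hψ => (h.d ψ hψ).symm,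
    fun ψ hψ => (h.k ψ hψ).symm, fun P xs hP hxs => (h.pred P xs hP hxs).symm⟩

theorem Agree.trans {s t r : Set (Formula Var ar)} (h : Agree V Φ Z s t) (h' : Agree V Φ Z t r) :
    Agree V Φ Z s r :=
  ⟨fun Y hY => (h.dep Y hY).trans (h'.dep Y hY), fun Y hY => (h.kdep Y hY).trans (h'.kdep Y hY),
    fun ψ hψ => (h.d ψ hψ).trans (h'.d ψ hψ), fun ψ hψ => (h.k ψ hψ).trans (h'.k ψ hψ),
    fun P xs hP hxs => (h.pred P xs hP hxs).trans (h'.pred P xs hP hxs)⟩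

theorem Agree.inherit {s t : Set (Formula Var ar)} (h : Agree V Φ Z s t) : Inherit V Φ Z s t :=
  ⟨fun Y hY => (h.kdep Y hY).1, fun ψ hψ => (h.k ψ hψ).1⟩

theorem Inherit.refl (s : Set (Formula Var ar)) : Inherit V Φ Z s s :=
  ⟨fun _ _ => id, fun _ _ => id⟩

theorem Inherit.trans {s t r : Set (Formula Var ar)} (h : Inherit V Φ Z s t)
    (h' : Inherit V Φ Z t r) : Inherit V Φ Z s r :=
  ⟨fun Y hY => h'.kdep Y hY ∘ h.kdep Y hY, fun ψ hψ => h'.k ψ hψ ∘ h.k ψ hψ⟩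

theorem weight_le_mul {e : Label Var × Node W} (hx : ¬ ConstVar V W x)
    (hx₁ : weight V Φ W x p e < 1) (hy₁ : weight V Φ W y p e < 1) :
    weight V Φ W y p e ≤ (p.2 + 1) * weight V Φ W x p e ∧ e.2.2 = p.2 := by
  obtain ⟨X, hX, t, hR, rfl⟩ | ⟨X, hX, n, t, hR, rfl⟩ := exists_rel_of_weight_lt_one hx hx₁
  all_goals
    refine ⟨?_, rfl⟩
    by_cases hy : ConstVar V W y
    · simp [weight_of_constVar hy]
  · simp [weight_det_of_dep hX hR (dep_of_weight_det_lt_one hy hy₁)]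
  · have hn := inv_le_weight_know (Φ := Φ) (p := p) (X := X) (n := n) hx (t, p.2)
    obtain hu | hk := udep_or_kdep_of_weight_know_lt_one hy hy₁
    · exact (weight_know_le_of_udep hX hR hu).trans
        (hn.trans (le_mul_of_one_le_left zero_le le_add_self))
    · exact ((weight_know_le_of_kdep hX hR hk).trans (min_le_right _ _)).trans
        (mul_le_mul_right hn _)

namespace QuasiModel

variable (hQ : QuasiModel V Φ W)
include hQ

theorem constVar_iff (s : W) (hx : x ∈ V) : ConstVar V W x ↔ Dep ∅ {x} ∈ s.1 := by
  refine ⟨fun h => h.elim (fun h => absurd hx h) fun h => h s s.2, fun h => Or.inr fun t ht => ?_⟩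
  have h₀ : Dep ∅ ∅ ∈ s.1 :=
    ((hQ.isType s s.2).depLike.iff_forall ∅ (by simp) ∅ (by simp)).2 (by simp)
  exact ((hQ.all s s.2 t ht ∅ (by simp) h₀).dep {x} (by simpa)).1 h

theorem dep_empty_of_forall_constVar (s : W) (hZ : Z ⊆ V) (h : ∀ z ∈ Z, ConstVar V W z) :
    Dep ∅ Z ∈ s.1 :=
  ((hQ.isType s s.2).depLike.iff_forall ∅ (by simp) Z hZ).2 fun z hz =>
    (hQ.constVar_iff s (hZ hz)).1 (h z hz)

theorem udep_of_constVar (s : W) (hX : X ⊆ V) (hx : x ∈ V) (hc : ConstVar V W x) :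
    UDep X {x} ∈ s.1 :=
  (hQ.isType s s.2).udep_of_const X hX _ (by simpa) ((hQ.constVar_iff s hx).1 hc)

theorem kdep_of_constVar (s : W) (hX : X ⊆ V) (hx : x ∈ V) (hc : ConstVar V W x) :
    KDep X {x} ∈ s.1 :=
  (hQ.isType s s.2).kdep_of_udep X hX _ (by simpa) (hQ.udep_of_constVar s hX hx hc)

theorem dep_of_constVar (s : W) (hX : X ⊆ V) (hx : x ∈ V) (hc : ConstVar V W x) :
    Dep X {x} ∈ s.1 :=
  (hQ.isType s s.2).dep_of_kdep X hX _ (by simpa) (hQ.kdep_of_constVar s hX hx hc)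

theorem constVar_of_dep (s : W) (hZ : Z ⊆ V) (h : ∀ z ∈ Z, ConstVar V W z) (hy : y ∈ V)
    (hZy : Dep Z {y} ∈ s.1) : ConstVar V W y :=
  (hQ.constVar_iff s hy).2 ((hQ.isType s s.2).depLike.trans ∅ (by simp) Z hZ _ (by simpa)
    (hQ.dep_empty_of_forall_constVar s hZ h) hZy)

theorem dep_of_kdep (s : W) (hZ : Z ⊆ V) (hy : y ∈ V) (hZy : KDep Z {y} ∈ s.1) :
    Dep Z {y} ∈ s.1 :=
  (hQ.isType s s.2).dep_of_kdep Z hZ _ (by simpa) hZy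

theorem kdep_of_udep (s : W) (hZ : Z ⊆ V) (hy : y ∈ V) (hZy : UDep Z {y} ∈ s.1) :
    KDep Z {y} ∈ s.1 :=
  (hQ.isType s s.2).kdep_of_udep Z hZ _ (by simpa) hZy

theorem dep_of_forall_weight_det_lt_one {q : Node W} (hX : X ⊆ V) (hZ : Z ⊆ V)
    (h : ∀ z ∈ Z, weight V Φ W z p (.det X, q) < 1) : Dep X Z ∈ p.1.1 := by
  refine ((hQ.isType _ p.1.2).depLike.iff_forall X hX Z hZ).2 fun z hz => ?_
  by_cases hc : ConstVar V W z
  · exact hQ.dep_of_constVar p.1 hX (hZ hz) hc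
  · exact dep_of_weight_det_lt_one hc (h z hz)

theorem kdep_of_forall_weight_know_lt_one {q : Node W} (hX : X ⊆ V) (hZ : Z ⊆ V)
    (h : ∀ z ∈ Z, weight V Φ W z p (.know X n, q) < 1) : KDep X Z ∈ p.1.1 := by
  refine ((hQ.isType _ p.1.2).kdepLike.iff_forall X hX Z hZ).2 fun z hz => ?_
  by_cases hc : ConstVar V W z
  · exact hQ.kdep_of_constVar p.1 hX (hZ hz) hc
  · exact (udep_or_kdep_of_weight_know_lt_one hc (h z hz)).elim
      (hQ.kdep_of_udep p.1 hX (hZ hz)) id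

theorem agree_of_weight_eq_zero {e : Label Var × Node W} (hZ : Z ⊆ V)
    (h : ∀ z ∈ Z, weight V Φ W z p e = 0) : Agree V Φ Z p.1 e.2.1 := by
  by_cases hc : ∀ z ∈ Z, ConstVar V W z
  · exact hQ.all _ p.1.2 _ e.2.1.2 Z hZ (hQ.dep_empty_of_forall_constVar p.1 hZ hc)
  push Not at hc
  obtain ⟨z, hz, hc⟩ := hc
  have h₁ : ∀ z ∈ Z, weight V Φ W z p e < 1 := fun z hz => by simp [h z hz]
  obtain ⟨X, hX, t, hR, rfl⟩ | ⟨X, -, n, t, -, rfl⟩ := exists_rel_of_weight_lt_one hc (h₁ z hz)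
  · exact hR Z hZ (hQ.dep_of_forall_weight_det_lt_one hX hZ h₁)
  · exact absurd (h z hz) ((inv_pos.2 (by positivity)).trans_le (inv_le_weight_know hc _)).ne'

theorem inherit_of_weight_lt_one {e : Label Var × Node W} (hZ : Z ⊆ V)
    (h : ∀ z ∈ Z, weight V Φ W z p e < 1) : Inherit V Φ Z p.1 e.2.1 := by
  by_cases hc : ∀ z ∈ Z, ConstVar V W z
  · exact (hQ.all _ p.1.2 _ e.2.1.2 Z hZ (hQ.dep_empty_of_forall_constVar p.1 hZ hc)).inherit
  push Not at hc
  obtain ⟨z, hz, hc⟩ := hc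
  obtain ⟨X, hX, t, hR, rfl⟩ | ⟨X, hX, n, t, hR, rfl⟩ := exists_rel_of_weight_lt_one hc (h z hz)
  · exact (hR Z hZ (hQ.dep_of_forall_weight_det_lt_one hX hZ h)).inherit
  · exact hR Z hZ (hQ.kdep_of_forall_weight_know_lt_one hX hZ h)

theorem weight_det_eq_zero_of_dep (hX : X ⊆ V) (hR : DRel V Φ X p.1 t) (hZ : Z ⊆ V)
    (h : ∀ z ∈ Z, weight V Φ W z p (.det X, t, p.2) < 1) (hy : y ∈ V) (hZy : Dep Z {y} ∈ p.1.1) :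
    weight V Φ W y p (.det X, t, p.2) = 0 :=
  weight_det_of_dep hX hR ((hQ.isType _ p.1.2).depLike.trans X hX Z hZ _ (by simpa)
    (hQ.dep_of_forall_weight_det_lt_one hX hZ h) hZy)

theorem weight_know_le_min_of_kdep (hX : X ⊆ V) (hR : KRel V Φ X p.1 t) (hZ : Z ⊆ V)
    (h : ∀ z ∈ Z, weight V Φ W z p (.know X n, t, p.2) < 1) (hy : y ∈ V)
    (hZy : KDep Z {y} ∈ p.1.1) :
    weight V Φ W y p (.know X n, t, p.2) ≤ min 1 ((p.2 + 1) * (n + 1 : ℝ≥0)⁻¹) :=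
  weight_know_le_of_kdep hX hR ((hQ.isType _ p.1.2).kdepLike.trans X hX Z hZ _ (by simpa)
    (hQ.kdep_of_forall_weight_know_lt_one hX hZ h) hZy)

theorem weight_eq_zero_of_dep {e : Label Var × Node W} (hZ : Z ⊆ V)
    (h : ∀ z ∈ Z, weight V Φ W z p e = 0) (hy : y ∈ V) (hZy : Dep Z {y} ∈ p.1.1) :
    weight V Φ W y p e = 0 := by
  by_cases hc : ∀ z ∈ Z, ConstVar V W z
  · exact weight_of_constVar (hQ.constVar_of_dep p.1 hZ hc hy hZy) _ _
  push Not at hc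
  obtain ⟨z, hz, hc⟩ := hc
  have h₁ : ∀ z ∈ Z, weight V Φ W z p e < 1 := fun z hz => by simp [h z hz]
  obtain ⟨X, hX, t, hR, rfl⟩ | ⟨X, -, n, t, -, rfl⟩ := exists_rel_of_weight_lt_one hc (h₁ z hz)
  · exact hQ.weight_det_eq_zero_of_dep hX hR hZ h₁ hy hZy
  · exact absurd (h z hz) ((inv_pos.2 (by positivity)).trans_le (inv_le_weight_know hc _)).ne'

theorem weight_le_mul_of_kdep {e : Label Var × Node W} (hZ : Z ⊆ V)
    (hc : ∃ z ∈ Z, ¬ ConstVar V W z) {r : ℝ≥0} (hr : r < 1)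
    (h : ∀ z ∈ Z, weight V Φ W z p e ≤ r) (hy : y ∈ V) (hZy : KDep Z {y} ∈ p.1.1) :
    weight V Φ W y p e ≤ (p.2 + 1) * r ∧ e.2.2 = p.2 := by
  obtain ⟨z, hz, hc⟩ := hc
  have h₁ : ∀ z ∈ Z, weight V Φ W z p e < 1 := fun z hz => (h z hz).trans_lt hr
  obtain ⟨X, hX, t, hR, rfl⟩ | ⟨X, hX, n, t, hR, rfl⟩ := exists_rel_of_weight_lt_one hc (h₁ z hz)
  · simp [hQ.weight_det_eq_zero_of_dep hX hR hZ h₁ hy (hQ.dep_of_kdep p.1 hZ hy hZy)]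
  · refine ⟨(hQ.weight_know_le_min_of_kdep hX hR hZ h₁ hy hZy).trans ?_, rfl⟩
    exact (min_le_right _ _).trans
      (mul_le_mul_right ((inv_le_weight_know hc _).trans (h z hz)) _)

theorem weight_le_of_udep {e : Label Var × Node W} (hZ : Z ⊆ V) {r : ℝ≥0} (hr : r < 1)
    (h : ∀ z ∈ Z, weight V Φ W z p e ≤ r) (hy : y ∈ V) (hZy : UDep Z {y} ∈ p.1.1) :
    weight V Φ W y p e ≤ r := by
  have hZy' := hQ.kdep_of_udep p.1 hZ hy hZy
  have hZy'' := hQ.dep_of_kdep p.1 hZ hy hZy'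
  by_cases hc : ∀ z ∈ Z, ConstVar V W z
  · simp [weight_of_constVar (hQ.constVar_of_dep p.1 hZ hc hy hZy'')]
  push Not at hc
  obtain ⟨z, hz, hc⟩ := hc
  have h₁ : ∀ z ∈ Z, weight V Φ W z p e < 1 := fun z hz => (h z hz).trans_lt hr
  obtain ⟨X, hX, t, hR, rfl⟩ | ⟨X, hX, n, t, hR, rfl⟩ := exists_rel_of_weight_lt_one hc (h₁ z hz)
  · simp [hQ.weight_det_eq_zero_of_dep hX hR hZ h₁ hy hZy'']
  have hU := (hQ.isType _ p.1.2).udepLike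
  by_cases hXZ : ∀ z ∈ Z, UDep X {z} ∈ p.1.1
  · have hXy : UDep X {y} ∈ p.1.1 :=
      hU.trans X hX Z hZ _ (by simpa) ((hU.iff_forall X hX Z hZ).2 hXZ) hZy
    exact (weight_know_le_of_udep hX hR hXy).trans ((inv_le_weight_know hc _).trans (h z hz))
  · push Not at hXZ
    obtain ⟨z', hz', hXz'⟩ := hXZ
    have hc' : ¬ ConstVar V W z' := fun hc' => hXz' (hQ.udep_of_constVar p.1 hX (hZ hz') hc')
    exact (hQ.weight_know_le_min_of_kdep hX hR hZ h₁ hy hZy').trans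
      ((min_le_weight_know hc' hXz' _).trans (h z' hz'))

theorem agree_of_height_eq_zero (hZ : Z ⊆ V) (l : List (Label Var × Node W)) (p : Node W)
    (h : ∀ z ∈ Z, height (weight V Φ W z) p l = 0) : Agree V Φ Z p.1 (endpt p l).1 := by
  induction l generalizing p with
  | nil => exact .refl _
  | cons e l ih =>
    simp only [height_cons_eq_zero] at h
    exact (hQ.agree_of_weight_eq_zero hZ fun z hz => (h z hz).1).trans
      (ih e.2 fun z hz => (h z hz).2)

theorem inherit_of_height_lt_one (hZ : Z ⊆ V) (l : List (Label Var × Node W)) (p : Node W)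
    (h : ∀ z ∈ Z, height (weight V Φ W z) p l < 1) : Inherit V Φ Z p.1 (endpt p l).1 := by
  induction l generalizing p with
  | nil => exact .refl _
  | cons e l ih =>
    simp only [height_cons, max_lt_iff] at h
    exact (hQ.inherit_of_weight_lt_one hZ fun z hz => (h z hz).1).trans
      (ih e.2 fun z hz => (h z hz).2)

theorem height_eq_zero_of_dep (hZ : Z ⊆ V) (hy : y ∈ V) (l : List (Label Var × Node W))
    (p : Node W) (h : ∀ z ∈ Z, height (weight V Φ W z) p l = 0) (hZy : Dep Z {y} ∈ p.1.1) :
    height (weight V Φ W y) p l = 0 := by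
  induction l generalizing p with
  | nil => rfl
  | cons e l ih =>
    simp only [height_cons_eq_zero] at h ⊢
    have hA := hQ.agree_of_weight_eq_zero hZ fun z hz => (h z hz).1
    exact ⟨hQ.weight_eq_zero_of_dep hZ (fun z hz => (h z hz).1) hy hZy,
      ih e.2 (fun z hz => (h z hz).2) ((hA.dep _ (by simpa)).1 hZy)⟩

theorem height_le_mul_of_kdep (hZ : Z ⊆ V) (hc : ∃ z ∈ Z, ¬ ConstVar V W z) {r : ℝ≥0}
    (hr : r < 1) (hy : y ∈ V) (l : List (Label Var × Node W)) (p : Node W)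
    (h : ∀ z ∈ Z, height (weight V Φ W z) p l ≤ r) (hZy : KDep Z {y} ∈ p.1.1) :
    height (weight V Φ W y) p l ≤ (p.2 + 1) * r ∧ (endpt p l).2 = p.2 := by
  induction l generalizing p with
  | nil => simp
  | cons e l ih =>
    simp only [height_cons, max_le_iff] at h ⊢
    obtain ⟨he, hN⟩ := hQ.weight_le_mul_of_kdep hZ hc hr (fun z hz => (h z hz).1) hy hZy
    have hI := hQ.inherit_of_weight_lt_one hZ fun z hz => (h z hz).1.trans_lt hr
    obtain ⟨hl, hN'⟩ := ih e.2 (fun z hz => (h z hz).2) (hI.kdep _ (by simpa) hZy)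
    rw [hN] at hl hN'
    exact ⟨⟨he, hl⟩, hN'⟩

theorem height_le_of_udep (hZ : Z ⊆ V) {r : ℝ≥0} (hr : r < 1) (hy : y ∈ V)
    (l : List (Label Var × Node W)) (p : Node W)
    (h : ∀ z ∈ Z, height (weight V Φ W z) p l ≤ r) (hZy : UDep Z {y} ∈ p.1.1) :
    height (weight V Φ W y) p l ≤ r := by
  induction l generalizing p with
  | nil => simp
  | cons e l ih =>
    simp only [height_cons, max_le_iff] at h ⊢
    exact ⟨hQ.weight_le_of_udep hZ hr (fun z hz => (h z hz).1) hy hZy,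
      ih e.2 (fun z hz => (h z hz).2) (hQ.udep _ p.1.2 _ e.2.1.2 Z hZ _ (by simpa) hZy)⟩

end QuasiModel

theorem height_le_mul (hx : ¬ ConstVar V W x) (l : List (Label Var × Node W)) (p : Node W)
    (hx₁ : height (weight V Φ W x) p l < 1) (hy₁ : height (weight V Φ W y) p l < 1) :
    height (weight V Φ W y) p l ≤ (p.2 + 1) * height (weight V Φ W x) p l ∧
      (endpt p l).2 = p.2 := by
  induction l generalizing p with
  | nil => simp
  | cons e l ih =>
    simp only [height_cons, max_lt_iff] at hx₁ hy₁ ⊢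
    obtain ⟨he, hN⟩ := weight_le_mul hx hx₁.1 hy₁.1
    obtain ⟨hl, hN'⟩ := ih e.2 hx₁.2 hy₁.2
    rw [hN] at hl hN'
    exact ⟨max_le (he.trans (mul_le_mul_right (le_max_left _ _) _))
      (hl.trans (mul_le_mul_right (le_max_right _ _) _)), hN'⟩

theorem height_of_constVar (hx : ConstVar V W x) (l : List (Label Var × Node W)) (p : Node W) :
    height (weight V Φ W x) p l = 0 := by
  induction l generalizing p with
  | nil => rfl
  | cons e l ih => simp [height_cons, weight_of_constVar hx, ih]

end Weight

/-! ### The metric model over a quasi-model -/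

theorem hasBasis_nnreal {α : Type*} {l : Filter α} {s : ℝ → Set α}
    (h : l.HasBasis (fun ε => 0 < ε) s) : l.HasBasis (fun ε : ℝ≥0 => 0 < ε) fun ε => s ε :=
  h.to_hasBasis (fun ε hε => ⟨⟨ε, hε.le⟩, hε, subset_rfl⟩) fun ε hε => ⟨ε, hε, subset_rfl⟩

theorem exists_inv_natCast_add_one_lt {δ : ℝ≥0} (hδ : 0 < δ) : ∃ n : ℕ, (n + 1 : ℝ≥0)⁻¹ < δ := by
  simpa only [one_div] using exists_nat_one_div_lt hδ

theorem eventually_eq_zero_of_lt (c : ℝ≥0) : ∀ᶠ δ in 𝓝[>] (0 : ℝ≥0), c < δ → c = 0 := by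
  obtain rfl | hc := eq_or_ne c 0
  · simp
  · filter_upwards [Ioo_mem_nhdsGT (pos_iff_ne_zero.2 hc)] with δ hδ h
    exact absurd h hδ.2.not_gt

theorem eventually_height_eq_zero_of_lt {P L : Type*} (w : P → L × P → ℝ≥0) (p : P)
    (l : List (L × P)) : ∀ᶠ δ in 𝓝[>] (0 : ℝ≥0), ∀ c a, l = c ++ a →
      height w (endpt p c) a < δ → height w (endpt p c) a = 0 := by
  induction l generalizing p with
  | nil => simp +contextual
  | cons e l ih =>
    filter_upwards [ih e.2, eventually_eq_zero_of_lt (height w p (e :: l))] with δ hl he c a hca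
    obtain ⟨rfl, rfl⟩ | ⟨c, rfl, rfl⟩ := List.cons_eq_append_iff.1 hca
    · exact he
    · exact hl c a rfl

variable {Var Pred : Type u} {ar : Pred → ℕ} (V : Finset Var) (Φ : Set (Formula Var ar))
  {W : Set (Set (Formula Var ar))} (s₀ : W) {X Y Z : Finset Var} {x y : Var}

/-- The states of the model: the finite paths over a quasi-model. -/
abbrev Path (W : Set (Set (Formula Var ar))) : Type u := List (Label Var × Node W)

/-- The distance between two paths with respect to the variable `x`. -/
noncomputable def pathDist (x : Var) (h h' : Path W) : ℝ≥0 :=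
  treeDist (weight V Φ W x) (s₀, 0) h h'

/-- The endpoint of a path from the root. -/
def tip (h : Path W) : Node W := endpt (s₀, 0) h

variable {s₀} in
theorem pathDist_append (x : Var) (h : Path W) (e : Label Var × Node W) :
    pathDist V Φ s₀ x h (h ++ [e]) = weight V Φ W x (tip s₀ h) e :=
  treeDist_append_singleton _ _ _ _

@[simp] theorem tip_append (h : Path W) (e : Label Var × Node W) :
    tip s₀ (h ++ [e]) = e.2 := by
  simp [tip]

theorem exists_fork (h h' : Path W) :
    ∃ (p : Node W) (a b : Path W), endpt p a = tip s₀ h ∧ endpt p b = tip s₀ h' ∧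
      ∀ x, pathDist V Φ s₀ x h h' =
        max (height (weight V Φ W x) p a) (height (weight V Φ W x) p b) := by
  obtain ⟨c, a, b, rfl, rfl, hd⟩ := exists_append_treeDist_eq ℝ≥0 ((s₀, 0) : Node W) h h'
  exact ⟨endpt (s₀, 0) c, a, b, by simp [tip], by simp [tip], fun x => hd _⟩

/-- Only finitely many heights occur on the way from the root to `h`, so a path sufficiently close
to `h` branches off at a node from which `h` no longer changes. -/
theorem eventually_exists_fork (Z : Finset Var) (h : Path W) :
    ∀ᶠ δ in 𝓝[>] (0 : ℝ≥0), ∀ h', (∀ z ∈ Z, pathDist V Φ s₀ z h h' < δ) →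
      ∃ (p : Node W) (a b : Path W), endpt p a = tip s₀ h ∧ endpt p b = tip s₀ h' ∧
        (∀ z ∈ Z, height (weight V Φ W z) p a = 0) ∧
        ∀ x, pathDist V Φ s₀ x h h' =
          max (height (weight V Φ W x) p a) (height (weight V Φ W x) p b) := by
  filter_upwards [(eventually_all_finset Z).2 fun z _ =>
    eventually_height_eq_zero_of_lt (weight V Φ W z) ((s₀, 0) : Node W) h] with δ hδ h' hh'
  obtain ⟨c, a, b, hc, rfl, hd⟩ := exists_append_treeDist_eq ℝ≥0 ((s₀, 0) : Node W) h h'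
  refine ⟨endpt (s₀, 0) c, a, b, by simp [tip, hc], by simp [tip], fun z hz => ?_, fun x => hd _⟩
  exact hδ z hz c a hc (((le_max_left _ _).trans (hd _).ge).trans_lt (hh' z hz))

/-- The paths with the pseudo-metric of the variable `x`. -/
def VarPath (_ : Finset Var) (_ : Set (Formula Var ar)) {W : Set (Set (Formula Var ar))}
    (_ : W) (_ : Var) : Type u := Path W

noncomputable instance (x : Var) : PseudoMetricSpace (VarPath V Φ s₀ x) where
  dist h h' := pathDist V Φ s₀ x h h'
  dist_self h := NNReal.coe_eq_zero.2 (treeDist_self _ _ _)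
  dist_comm h h' := congrArg _ (treeDist_comm _ _ _ _)
  dist_triangle h h' h'' := NNReal.coe_le_coe.2
    ((treeDist_le_max _ _ h h' h'').trans (max_le_add_of_nonneg zero_le zero_le))

/-- The metric model over a quasi-model. The values of a variable are the classes of paths at
distance zero; the ranges of different variables are disjoint. -/
noncomputable def pathModel : MetricModel Var ar where
  Val := Σ x, SeparationQuotient (VarPath V Φ s₀ x)
  Rng x := Set.range (Sigma.mk x)
  metric x := .induced (Equiv.ofInjective _ sigma_mk_injective).symm (Equiv.injective _)
    inferInstance
  interp P := {a | ∃ (xs : Fin (ar P) → Var) (h : Path W), pred P xs ∈ Φ ∧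
    pred P xs ∈ (tip s₀ h).1.1 ∧ ∀ i, (a i).1 = ⟨xs i, .mk h⟩}
  State := Path W
  val x h := ⟨⟨x, .mk h⟩, _, rfl⟩
  surj x := by
    rintro ⟨_, q, rfl⟩
    obtain ⟨h, rfl⟩ := SeparationQuotient.surjective_mk q
    exact ⟨h, rfl⟩

/-- A path as a state of the metric model over a quasi-model. -/
def pathState (h : Path W) : (pathModel V Φ s₀).State := h

theorem pathState_surjective : Function.Surjective (pathState V Φ s₀) := fun h => ⟨h, rfl⟩

variable {V Φ s₀}

theorem dist_val_pathState (x : Var) (h h' : Path W) :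
    dist ((pathModel V Φ s₀).val x (pathState V Φ s₀ h))
      ((pathModel V Φ s₀).val x (pathState V Φ s₀ h')) = pathDist V Φ s₀ x h h' := by
  have key (h : Path W) : (Equiv.ofInjective _ sigma_mk_injective).symm
      ((pathModel V Φ s₀).val x (pathState V Φ s₀ h)) = (SeparationQuotient.mk h :
        SeparationQuotient (VarPath V Φ s₀ x)) := Equiv.ofInjective_symm_apply _ _
  exact (congrArg₂ dist (key h) (key h')).trans (SeparationQuotient.dist_mk _ _)

theorem val_pathState_eq_iff {h h' : Path W} :
    (pathModel V Φ s₀).val x (pathState V Φ s₀ h) = (pathModel V Φ s₀).val x (pathState V Φ s₀ h') ↔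
      pathDist V Φ s₀ x h h' = 0 := by
  rw [← dist_eq_zero, dist_val_pathState, NNReal.coe_eq_zero]

theorem joint_pathState_eq_iff {h h' : Path W} :
    (pathModel V Φ s₀).joint X (pathState V Φ s₀ h) =
      (pathModel V Φ s₀).joint X (pathState V Φ s₀ h') ↔
      ∀ x ∈ X, pathDist V Φ s₀ x h h' = 0 := by
  simp only [MetricModel.joint_eq_iff, val_pathState_eq_iff]

theorem stateDist_pathState_lt_iff {h h' : Path W} {ε : ℝ≥0} (hε : 0 < ε) :
    (pathModel V Φ s₀).stateDist X (pathState V Φ s₀ h) (pathState V Φ s₀ h') < ε ↔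
      ∀ x ∈ X, pathDist V Φ s₀ x h h' < ε := by
  simp only [MetricModel.stateDist_lt_iff _ (NNReal.coe_pos.2 hε), dist_val_pathState,
    NNReal.coe_lt_coe]

theorem eventually_nhdsOn_pathState {h : Path W} {p : (pathModel V Φ s₀).State → Prop} :
    (∀ᶠ w in (pathModel V Φ s₀).nhdsOn X (pathState V Φ s₀ h), p w) ↔
      ∃ δ > 0, ∀ h', (∀ x ∈ X, pathDist V Φ s₀ x h h' < δ) → p (pathState V Φ s₀ h') :=
  (hasBasis_nnreal (MetricModel.nhdsOn_basis _ _ _)).eventually_iff.trans <|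
    exists_congr fun _ => and_congr_right fun hδ => (pathState_surjective V Φ s₀).forall.trans <|
      forall_congr' fun _ => imp_congr_left (stateDist_pathState_lt_iff hδ)

theorem nhdsOn_pathState_le_iff {h : Path W} :
    (pathModel V Φ s₀).nhdsOn X (pathState V Φ s₀ h) ≤
      (pathModel V Φ s₀).nhdsOn Y (pathState V Φ s₀ h) ↔
      ∀ ε > 0, ∃ δ > 0, ∀ h', (∀ x ∈ X, pathDist V Φ s₀ x h h' < δ) →
        ∀ y ∈ Y, pathDist V Φ s₀ y h h' < ε :=
  (hasBasis_nnreal (MetricModel.nhdsOn_basis _ _ _)).ge_iff.trans <| forall₂_congr fun _ hε => by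
    simp only [← stateDist_pathState_lt_iff hε]
    exact eventually_nhdsOn_pathState

theorem uniformityOn_pathModel_le_iff :
    (pathModel V Φ s₀).uniformityOn X ≤ (pathModel V Φ s₀).uniformityOn Y ↔
      ∀ ε > 0, ∃ δ > 0, ∀ h h', (∀ x ∈ X, pathDist V Φ s₀ x h h' < δ) →
        ∀ y ∈ Y, pathDist V Φ s₀ y h h' < ε :=
  ((hasBasis_nnreal (MetricModel.uniformityOn_basis _ _)).le_basis_iff
      (hasBasis_nnreal (MetricModel.uniformityOn_basis _ _))).trans <|
    forall₂_congr fun _ hε => exists_congr fun _ => and_congr_right fun hδ => by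
      simp only [Set.subset_def, Prod.forall, (pathState_surjective V Φ s₀).forall,
        Set.mem_ofPred_eq, stateDist_pathState_lt_iff hε, stateDist_pathState_lt_iff hδ]

theorem pathDist_of_constVar (hx : ConstVar V W x) (h h' : Path W) :
    pathDist V Φ s₀ x h h' = 0 := by
  obtain ⟨p, a, b, -, -, hd⟩ := exists_fork V Φ s₀ h h'
  rw [hd, height_of_constVar hx, height_of_constVar hx, max_self]

theorem pathDist_le_mul (hx : ¬ ConstVar V W x) {h h' : Path W}
    (hx₁ : pathDist V Φ s₀ x h h' < 1) (hy₁ : pathDist V Φ s₀ y h h' < 1) :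
    pathDist V Φ s₀ y h h' ≤ ((tip s₀ h).2 + 1) * pathDist V Φ s₀ x h h' ∧
      (tip s₀ h').2 = (tip s₀ h).2 := by
  obtain ⟨p, a, b, ha, hb, hd⟩ := exists_fork V Φ s₀ h h'
  simp only [hd, max_lt_iff] at hx₁ hy₁ ⊢
  obtain ⟨ha₁, ha₂⟩ := height_le_mul hx a p hx₁.1 hy₁.1
  obtain ⟨hb₁, hb₂⟩ := height_le_mul hx b p hx₁.2 hy₁.2
  rw [← ha, ← hb, ha₂, hb₂, mul_max_of_nonneg _ _ zero_le]
  exact ⟨max_le_max ha₁ hb₁, rfl⟩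

theorem pathDist_lt_of_lt {δ : ℝ≥0} {h r t : Path W} (hr : pathDist V Φ s₀ x r h < δ)
    (ht : pathDist V Φ s₀ x t h < δ) : pathDist V Φ s₀ x r t < δ :=
  (treeDist_le_max _ _ r h t).trans_lt (max_lt hr (by rwa [treeDist_comm]))

theorem pathModel_isPseudoLocallyLipschitz :
    (pathModel V Φ s₀).IsPseudoLocallyLipschitz := by
  intro x y hx
  have hc : ¬ ConstVar V W x := fun hc => hx <| by
    simp only [MetricModel.IsConstant, (pathState_surjective V Φ s₀).forall₂, val_pathState_eq_iff,
      pathDist_of_constVar hc, implies_true]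
  let _ : PseudoMetricSpace (pathModel V Φ s₀).State :=
    .induced ((pathModel V Φ s₀).val x) inferInstance
  have dist_state (h h' : Path W) :
      dist (pathState V Φ s₀ h) (pathState V Φ s₀ h') = pathDist V Φ s₀ x h h' :=
    dist_val_pathState x h h'
  refine (pathState_surjective V Φ s₀).forall.2 fun h => ⟨Metric.ball (pathState V Φ s₀ h) 1,
    Metric.ball ((pathModel V Φ s₀).val y (pathState V Φ s₀ h)) 1, Metric.isOpen_ball,
    Metric.mem_ball_self one_pos, Metric.isOpen_ball, Metric.mem_ball_self one_pos,
    (tip s₀ h).2 + 1, LipschitzOnWith.of_dist_le_mul ?_⟩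
  simp only [(pathState_surjective V Φ s₀).forall, Set.mem_inter_iff, Set.mem_preimage,
    Metric.mem_ball, dist_state, dist_val_pathState]
  norm_cast
  rintro r ⟨hrx, hry⟩ t ⟨htx, hty⟩
  have hN := (pathDist_le_mul hc hrx hry).2
  rw [hN]
  exact_mod_cast (pathDist_le_mul hc (pathDist_lt_of_lt hrx htx) (pathDist_lt_of_lt hry hty)).1

/-! ### The truth lemma -/

theorem DRel.refl (s : Set (Formula Var ar)) : DRel V Φ X s s := fun _ _ _ => .refl _

theorem KRel.refl (s : Set (Formula Var ar)) : KRel V Φ X s s := fun _ _ _ => .refl _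

namespace QuasiModel

variable (hQ : QuasiModel V Φ W)
include hQ

theorem agree_tip (hZ : Z ⊆ V) {h h' : Path W} (hd : ∀ z ∈ Z, pathDist V Φ s₀ z h h' = 0) :
    Agree V Φ Z (tip s₀ h).1 (tip s₀ h').1 := by
  obtain ⟨p, a, b, ha, hb, hab⟩ := exists_fork V Φ s₀ h h'
  have h₀ z (hz : z ∈ Z) := max_eq_bot.1 ((hab z).symm.trans (hd z hz))
  rw [← ha, ← hb]
  exact (hQ.agree_of_height_eq_zero hZ a p fun z hz => (h₀ z hz).1).symm.trans
    (hQ.agree_of_height_eq_zero hZ b p fun z hz => (h₀ z hz).2)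

theorem pathDist_eq_zero_of_dep (hX : X ⊆ V) (hy : y ∈ V) {h h' : Path W}
    (hd : ∀ x ∈ X, pathDist V Φ s₀ x h h' = 0) (hXy : Dep X {y} ∈ (tip s₀ h).1.1) :
    pathDist V Φ s₀ y h h' = 0 := by
  obtain ⟨p, a, b, ha, -, hab⟩ := exists_fork V Φ s₀ h h'
  have h₀ x (hx : x ∈ X) := max_eq_bot.1 ((hab x).symm.trans (hd x hx))
  have hp : Dep X {y} ∈ p.1.1 :=
    ((hQ.agree_of_height_eq_zero hX a p fun x hx => (h₀ x hx).1).dep {y} (by simpa)).2 (ha ▸ hXy)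
  rw [hab, hQ.height_eq_zero_of_dep hX hy a p (fun x hx => (h₀ x hx).1) hp,
    hQ.height_eq_zero_of_dep hX hy b p (fun x hx => (h₀ x hx).2) hp, max_self]

theorem pathDist_le_of_udep (hX : X ⊆ V) (hy : y ∈ V) {r : ℝ≥0} (hr : r < 1) {h h' : Path W}
    (hd : ∀ x ∈ X, pathDist V Φ s₀ x h h' ≤ r) {s : W} (hXy : UDep X {y} ∈ s.1) :
    pathDist V Φ s₀ y h h' ≤ r := by
  obtain ⟨p, a, b, -, -, hab⟩ := exists_fork V Φ s₀ h h'
  have hr' x (hx : x ∈ X) := max_le_iff.1 ((hab x).symm.trans_le (hd x hx))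
  have hp : UDep X {y} ∈ p.1.1 := hQ.udep _ s.2 _ p.1.2 X hX _ (by simpa) hXy
  rw [hab]
  exact max_le (hQ.height_le_of_udep hX hr hy a p (fun x hx => (hr' x hx).1) hp)
    (hQ.height_le_of_udep hX hr hy b p (fun x hx => (hr' x hx).2) hp)

theorem eventually_inherit_tip (hZ : Z ⊆ V) (h : Path W) :
    ∀ᶠ δ in 𝓝[>] (0 : ℝ≥0), ∀ h', (∀ z ∈ Z, pathDist V Φ s₀ z h h' < δ) →
      Inherit V Φ Z (tip s₀ h).1 (tip s₀ h').1 := by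
  filter_upwards [eventually_exists_fork V Φ s₀ Z h, Ioo_mem_nhdsGT one_pos] with δ H hδ h' hd
  obtain ⟨p, a, b, ha, hb, hz, hab⟩ := H h' hd
  rw [← ha, ← hb]
  exact (hQ.agree_of_height_eq_zero hZ a p hz).symm.inherit.trans <|
    hQ.inherit_of_height_lt_one hZ b p fun z hz =>
      (le_max_right _ _).trans_lt ((hab z).symm.trans_lt ((hd z hz).trans hδ.2))

theorem eventually_pathDist_le_mul_of_kdep (hX : X ⊆ V) (hc : ∃ x ∈ X, ¬ ConstVar V W x)
    (h : Path W) :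
    ∀ᶠ δ in 𝓝[>] (0 : ℝ≥0), ∀ h', (∀ x ∈ X, pathDist V Φ s₀ x h h' < δ) →
      ∀ y ∈ V, KDep X {y} ∈ (tip s₀ h).1.1 →
        pathDist V Φ s₀ y h h' ≤ ((tip s₀ h).2 + 1) * δ := by
  filter_upwards [eventually_exists_fork V Φ s₀ X h, Ioo_mem_nhdsGT one_pos] with δ H hδ h' hd y hy
    hXy
  obtain ⟨p, a, b, ha, -, hz, hab⟩ := H h' hd
  have hp : KDep X {y} ∈ p.1.1 :=
    ((hQ.agree_of_height_eq_zero hX a p hz).kdep {y} (by simpa)).2 (ha ▸ hXy)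
  have hδ' x (hx : x ∈ X) := max_le_iff.1 ((hab x).symm.trans_le (hd x hx).le)
  obtain ⟨h₁, hN⟩ :=
    hQ.height_le_mul_of_kdep hX hc hδ.2 hy a p (fun x hx => (hδ' x hx).1) hp
  obtain ⟨h₂, -⟩ := hQ.height_le_mul_of_kdep hX hc hδ.2 hy b p (fun x hx => (hδ' x hx).2) hp
  rw [hab, ← ha, hN]
  exact max_le h₁ h₂

theorem nhdsOn_pathState_le_of_kdep (hX : X ⊆ V) (hY : Y ⊆ V) {h : Path W}
    (hXY : KDep X Y ∈ (tip s₀ h).1.1) :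
    (pathModel V Φ s₀).nhdsOn X (pathState V Φ s₀ h) ≤
      (pathModel V Φ s₀).nhdsOn Y (pathState V Φ s₀ h) := by
  have hXy := ((hQ.isType _ (tip s₀ h).1.2).kdepLike.iff_forall X hX Y hY).1 hXY
  rw [nhdsOn_pathState_le_iff]
  intro ε hε
  by_cases hc : ∀ x ∈ X, ConstVar V W x
  · refine ⟨1, one_pos, fun h' _ y hy => ?_⟩
    rwa [pathDist_of_constVar (hQ.constVar_of_dep _ hX hc (hY hy)
      (hQ.dep_of_kdep _ hX (hY hy) (hXy y hy)))]
  push Not at hc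
  have hmul : Tendsto (fun δ : ℝ≥0 => ((tip s₀ h).2 + 1) * δ) (𝓝[>] 0) (𝓝 0) :=
    Continuous.tendsto' (by fun_prop) _ _ (mul_zero _) |>.mono_left nhdsWithin_le_nhds
  obtain ⟨δ, ⟨H, hδε⟩, hδ⟩ := ((hQ.eventually_pathDist_le_mul_of_kdep hX hc h).and
    (hmul.eventually_lt_const hε)).and self_mem_nhdsWithin |>.exists
  exact ⟨δ, hδ, fun h' hd y hy => (H h' hd y (hY hy) (hXy y hy)).trans_lt hδε⟩

theorem pathDist_append_det (hX : X ⊆ V) {h : Path W} {t : W}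
    (hR : DRel V Φ X (tip s₀ h).1 t) (hx : x ∈ X) :
    pathDist V Φ s₀ x h (h ++ [(.det X, t, (tip s₀ h).2)]) = 0 := by
  rw [pathDist_append]
  exact weight_det_of_dep hX hR ((hQ.isType _ (tip s₀ h).1.2).depLike.refl X hX x hx)

theorem pathDist_append_know_le (hX : X ⊆ V) {h : Path W} {t : W}
    (hR : KRel V Φ X (tip s₀ h).1 t) (hx : x ∈ X) (n : ℕ) :
    pathDist V Φ s₀ x h (h ++ [(.know X n, t, (tip s₀ h).2)]) ≤ (n + 1 : ℝ≥0)⁻¹ := by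
  rw [pathDist_append]
  exact weight_know_le_of_udep hX hR ((hQ.isType _ (tip s₀ h).1.2).udepLike.refl X hX x hx)

theorem dep_of_pathDist_append_det_lt_one (hX : X ⊆ V) (hy : y ∈ V) {h : Path W} {q : Node W}
    (hd : pathDist V Φ s₀ y h (h ++ [(.det X, q)]) < 1) : Dep X {y} ∈ (tip s₀ h).1.1 := by
  rw [pathDist_append] at hd
  exact hQ.dep_of_forall_weight_det_lt_one hX (by simpa) (by simpa using hd)

theorem kdep_of_pathDist_append_know_lt_one (hX : X ⊆ V) (hy : y ∈ V) {h : Path W} {q : Node W}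
    {n : ℕ} (hd : pathDist V Φ s₀ y h (h ++ [(.know X n, q)]) < 1) :
    KDep X {y} ∈ (tip s₀ h).1.1 := by
  rw [pathDist_append] at hd
  exact hQ.kdep_of_forall_weight_know_lt_one hX (by simpa) (by simpa using hd)

theorem udep_of_pathDist_append_know_lt_one (hX : X ⊆ V) (hy : y ∈ V) {h : Path W} {q : Node W}
    (hd : pathDist V Φ s₀ y h (h ++ [(.know X (tip s₀ h).2, q)]) < 1) :
    UDep X {y} ∈ (tip s₀ h).1.1 := by
  by_contra hn
  have hc : ¬ ConstVar V W y := fun hc => hn (hQ.udep_of_constVar _ hX hy hc)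
  rw [pathDist_append] at hd
  refine hd.not_ge (le_trans ?_ (min_le_weight_know hc hn q))
  simp

theorem sat_pred_iff {P : Pred} {xs : Fin (ar P) → Var} (hΦ : pred P xs ∈ Φ) (h : Path W) :
    (pathModel V Φ s₀).Sat (pred P xs) (pathState V Φ s₀ h) ↔ pred P xs ∈ (tip s₀ h).1.1 := by
  classical
  refine ⟨?_, fun hm => ⟨xs, h, hΦ, hm, fun i => rfl⟩⟩
  rintro ⟨ys, h', -, hm, heq⟩
  obtain rfl : xs = ys := funext fun i => congrArg Sigma.fst (heq i)
  have hV : Finset.univ.image xs ⊆ V := by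
    simpa [Finset.image_subset_iff] using hQ.subClosed.pred P xs hΦ
  refine ((hQ.agree_tip hV ?_).pred P xs hΦ (by simp)).2 hm
  simp only [Finset.mem_image, Finset.mem_univ, true_and, forall_exists_index,
    forall_apply_eq_imp_iff]
  exact fun i => val_pathState_eq_iff.1 (Subtype.ext (heq i))

theorem sat_D_iff {ψ : Formula Var ar} (hΦ : D X ψ ∈ Φ)
    (hψ : ∀ h, (pathModel V Φ s₀).Sat ψ (pathState V Φ s₀ h) ↔ ψ ∈ (tip s₀ h).1.1) (h : Path W) :
    (pathModel V Φ s₀).Sat (D X ψ) (pathState V Φ s₀ h) ↔ D X ψ ∈ (tip s₀ h).1.1 := by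
  have hX := (hQ.subClosed.d X ψ hΦ).1
  refine ⟨fun hs => ?_, fun hm => (pathState_surjective V Φ s₀).forall.2 fun h' hh' => ?_⟩
  · by_contra hn
    obtain ⟨t, ht, hR, hψt⟩ := hQ.d _ (tip s₀ h).1.2 X ψ hΦ hn
    have := hs _ (joint_pathState_eq_iff.2 fun x hx =>
      hQ.pathDist_append_det hX (h := h) (t := ⟨t, ht⟩) hR hx)
    exact hψt (by simpa [hψ] using this)
  · exact (hψ h').2 ((hQ.isType _ (tip s₀ h').1.2).d X ψ hΦ
      (((hQ.agree_tip hX (joint_pathState_eq_iff.1 hh')).d ψ hΦ).1 hm))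

theorem sat_Dep_iff (hX : X ⊆ V) (hY : Y ⊆ V) (h : Path W) :
    (pathModel V Φ s₀).Sat (Dep X Y) (pathState V Φ s₀ h) ↔ Dep X Y ∈ (tip s₀ h).1.1 := by
  rw [(hQ.isType _ (tip s₀ h).1.2).depLike.iff_forall X hX Y hY]
  refine ⟨fun hs y hy => ?_, fun hm => (pathState_surjective V Φ s₀).forall.2 fun h' hh' => ?_⟩
  · have := hs _ (joint_pathState_eq_iff.2 fun x hx =>
      hQ.pathDist_append_det hX (h := h) (.refl _) hx)
    exact hQ.dep_of_pathDist_append_det_lt_one hX (hY hy)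
      ((joint_pathState_eq_iff.1 this y hy).trans_lt one_pos)
  · exact joint_pathState_eq_iff.2 fun y hy => hQ.pathDist_eq_zero_of_dep hX (hY hy)
      (joint_pathState_eq_iff.1 hh') (hm y hy)

theorem sat_K_iff {ψ : Formula Var ar} (hΦ : K X ψ ∈ Φ)
    (hψ : ∀ h, (pathModel V Φ s₀).Sat ψ (pathState V Φ s₀ h) ↔ ψ ∈ (tip s₀ h).1.1) (h : Path W) :
    (pathModel V Φ s₀).Sat (K X ψ) (pathState V Φ s₀ h) ↔ K X ψ ∈ (tip s₀ h).1.1 := by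
  have hX := (hQ.subClosed.k X ψ hΦ).1
  simp only [MetricModel.sat_K, eventually_nhdsOn_pathState, hψ]
  refine ⟨fun ⟨δ, hδ, hs⟩ => ?_, fun hm => ?_⟩
  · by_contra hn
    obtain ⟨t, ht, hR, hψt⟩ := hQ.k _ (tip s₀ h).1.2 X ψ hΦ hn
    obtain ⟨n, hn⟩ := exists_inv_natCast_add_one_lt hδ
    have := hs _ fun x hx =>
      (hQ.pathDist_append_know_le hX (t := ⟨t, ht⟩) hR hx n).trans_lt hn
    exact hψt (by simpa using this)
  · obtain ⟨δ, H, hδ⟩ := ((hQ.eventually_inherit_tip hX h).and self_mem_nhdsWithin).exists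
    exact ⟨δ, hδ, fun h' hd =>
      (hQ.isType _ (tip s₀ h').1.2).k X ψ hΦ ((H h' hd).k ψ hΦ hm)⟩

theorem sat_KDep_iff (hX : X ⊆ V) (hY : Y ⊆ V) (h : Path W) :
    (pathModel V Φ s₀).Sat (KDep X Y) (pathState V Φ s₀ h) ↔ KDep X Y ∈ (tip s₀ h).1.1 := by
  rw [MetricModel.sat_KDep]
  refine ⟨fun hs => ?_, fun hm => ?_⟩
  · refine ((hQ.isType _ (tip s₀ h).1.2).kdepLike.iff_forall X hX Y hY).2 fun y hy => ?_
    obtain ⟨δ, hδ, H⟩ :=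
      nhdsOn_pathState_le_iff.1 (MetricModel.eventually_nhdsOn_self hs) 1 one_pos
    obtain ⟨n, hn⟩ := exists_inv_natCast_add_one_lt hδ
    exact hQ.kdep_of_pathDist_append_know_lt_one hX (hY hy) <|
      H _ (fun x hx => (hQ.pathDist_append_know_le hX (.refl _) hx n).trans_lt hn) y hy
  · obtain ⟨δ, H, hδ⟩ := ((hQ.eventually_inherit_tip hX h).and self_mem_nhdsWithin).exists
    exact eventually_nhdsOn_pathState.2 ⟨δ, hδ, fun h' hd =>
      hQ.nhdsOn_pathState_le_of_kdep hX hY ((H h' hd).kdep Y hY hm)⟩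

theorem sat_UDep_iff (hX : X ⊆ V) (hY : Y ⊆ V) (h : Path W) :
    (pathModel V Φ s₀).Sat (UDep X Y) (pathState V Φ s₀ h) ↔ UDep X Y ∈ (tip s₀ h).1.1 := by
  rw [MetricModel.sat_UDep, uniformityOn_pathModel_le_iff,
    (hQ.isType _ (tip s₀ h).1.2).udepLike.iff_forall X hX Y hY]
  refine ⟨fun hs y hy => ?_, fun hm ε hε => ?_⟩
  · obtain ⟨δ, hδ, H⟩ := hs 1 one_pos
    obtain ⟨n, hn⟩ := exists_inv_natCast_add_one_lt hδ
    -- Jump to the same type with local constant `n + 1`, which makes the dependence fail at `δ`.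
    set h' : Path W := h ++ [(.det ∅, (tip s₀ h).1, n)]
    have htip : tip s₀ h' = ((tip s₀ h).1, n) := tip_append ..
    have hd := H h' (h' ++ [(.know X (tip s₀ h').2, (tip s₀ h').1, (tip s₀ h').2)]) (fun x hx =>
      (hQ.pathDist_append_know_le hX (.refl _) hx _).trans_lt (by rwa [htip])) y hy
    simpa [htip] using hQ.udep_of_pathDist_append_know_lt_one hX (hY hy) hd
  · obtain ⟨δ, hδ, hδ'⟩ := exists_between (lt_min hε one_pos)
    rw [lt_min_iff] at hδ'
    exact ⟨δ, hδ, fun h₁ h₂ hd y hy => (hQ.pathDist_le_of_udep hX (hY hy) hδ'.2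
      (fun x hx => (hd x hx).le) (hm y hy)).trans_lt hδ'.1⟩

theorem sat_iff (ψ : Formula Var ar) (hψ : ψ ∈ Φ) (h : Path W) :
    (pathModel V Φ s₀).Sat ψ (pathState V Φ s₀ h) ↔ ψ ∈ (tip s₀ h).1.1 := by
  induction ψ generalizing h with
  | pred P xs => exact hQ.sat_pred_iff hψ h
  | neg ψ ih =>
    rw [(hQ.isType _ (tip s₀ h).1.2).neg ψ hψ, ← ih (hQ.subClosed.neg ψ hψ) h]
    rfl
  | and ψ χ ih₁ ih₂ =>
    obtain ⟨h₁, h₂⟩ := hQ.subClosed.and ψ χ hψ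
    rw [(hQ.isType _ (tip s₀ h).1.2).and ψ χ hψ, ← ih₁ h₁ h, ← ih₂ h₂ h]
    rfl
  | D X ψ ih => exact hQ.sat_D_iff hψ (ih (hQ.subClosed.d X ψ hψ).2) h
  | Dep X Y => exact hQ.sat_Dep_iff (hQ.subClosed.dep X Y hψ).1 (hQ.subClosed.dep X Y hψ).2 h
  | K X ψ ih => exact hQ.sat_K_iff hψ (ih (hQ.subClosed.k X ψ hψ).2) h
  | KDep X Y => exact hQ.sat_KDep_iff (hQ.subClosed.kdep X Y hψ).1 (hQ.subClosed.kdep X Y hψ).2 h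
  | UDep X Y => exact hQ.sat_UDep_iff (hQ.subClosed.udep X Y hψ).1 (hQ.subClosed.udep X Y hψ).2 h

theorem exists_countermodel {φ : Formula Var ar} (hφ : φ ∈ Φ) (hW : ∃ s ∈ W, φ ∉ s) :
    ∃ M : MetricModel Var ar, M.IsPseudoLocallyLipschitz ∧ ¬ M.Valid φ := by
  obtain ⟨s, hs, hφs⟩ := hW
  refine ⟨pathModel V Φ ⟨s, hs⟩, pathModel_isPseudoLocallyLipschitz, fun hv => hφs ?_⟩
  exact (hQ.sat_iff φ hφ []).1 (hv (pathState V Φ ⟨s, hs⟩ []))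

end QuasiModel

/-! ### Completeness -/

section Completeness

variable {Var Pred : Type u} [DecidableEq Var] {ar : Pred → ℕ} {φ : Formula Var ar}

theorem exists_countermodel_of_not_provable (hφ : ¬ Provable φ) :
    ∃ M : MetricModel Var ar, M.IsPseudoLocallyLipschitz ∧ ¬ M.Valid φ := by
  obtain ⟨W, hQ, hW⟩ := exists_quasiModel_of_not_provable hφ
  exact hQ.exists_countermodel φ.self_mem_subformulas hW

theorem provable_tfae (φ : Formula Var ar) :
    [Provable φ, MetricValid φ, ConcreteValid φ, LipschitzValid φ].TFAE := by
  tfae_have 1 → 2 := fun h M => M.valid_of_provable h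
  tfae_have 2 → 3 := fun h M => h M.toMetricModel
  tfae_have 3 → 2 := fun h M s => (M.sat_toAssignment φ s).1 (h M.toConcrete _)
  tfae_have 2 → 4 := fun h M _ => h M
  tfae_have 4 → 1 := by
    contrapose!
    intro hφ h
    obtain ⟨M, hM, hMφ⟩ := exists_countermodel_of_not_provable hφ
    exact hMφ (h M hM)
  tfae_finish

theorem exists_quasiModel_iff_not_metricValid :
    (∃ W, QuasiModel φ.vars φ.subformulas W ∧ ∃ s ∈ W, φ ∉ s) ↔ ¬ MetricValid φ := by
  refine ⟨fun ⟨W, hQ, hW⟩ hφ => ?_, fun hφ => ?_⟩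
  · obtain ⟨M, -, hM⟩ := hQ.exists_countermodel φ.self_mem_subformulas hW
    exact hM (hφ M)
  · exact exists_quasiModel_of_not_provable (mt ((provable_tfae φ).out 0 1).1 hφ)

end Completeness

/-! ### Quasi-models coded by numbers -/

namespace Coded

/-- The number `i` belongs to the set coded by `m`: sets of numbers are coded by their binary
digits. -/
def Mem (i m : ℕ) : Prop := m.testBit i = true

/-- Inclusion of coded sets. -/
def Sub (X v : ℕ) : Prop := ∀ i < X, Mem i X → Mem i v

/-- The Gödel number of a formula with the tag `k` and two arguments. -/
def node (k X Y : ℕ) : ℕ := Nat.pair k (Nat.pair X Y)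

/-- The list of numbers with a given code. -/
def list (l : ℕ) : List ℕ := (Encodable.decode (α := List ℕ) l).getD []

/-- Coded version of `LUD.Agree`: here and below `v`, `p`, `w` code the set of variables, the set of
formulas and the quasi-model, and a type is coded by the set of the Gödel numbers of its elements.
Every quantifier is bounded by a code, which makes the notions primitive recursive. -/
def Agree (v p Z s t : ℕ) : Prop :=
  (∀ Y < v + 1, Sub Y v → (Mem (node 4 Z Y) s ↔ Mem (node 4 Z Y) t)) ∧
  (∀ Y < v + 1, Sub Y v → (Mem (node 6 Z Y) s ↔ Mem (node 6 Z Y) t)) ∧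
  (∀ c < p, Mem (node 3 Z c) p → (Mem (node 3 Z c) s ↔ Mem (node 3 Z c) t)) ∧
  (∀ c < p, Mem (node 5 Z c) p → (Mem (node 5 Z c) s ↔ Mem (node 5 Z c) t)) ∧
  (∀ P < p, ∀ l < p, Mem (node 0 P l) p → (∀ y ∈ list l, Mem y Z) →
    (Mem (node 0 P l) s ↔ Mem (node 0 P l) t))

/-- Coded version of `LUD.Inherit`. -/
def Inherit (v p Z s t : ℕ) : Prop :=
  (∀ Y < v + 1, Sub Y v → Mem (node 6 Z Y) s → Mem (node 6 Z Y) t) ∧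
  (∀ c < p, Mem (node 5 Z c) p → Mem (node 5 Z c) s → Mem (node 5 Z c) t)

/-- Coded version of `LUD.DRel`. -/
def DRel (v p X s t : ℕ) : Prop :=
  ∀ Z < v + 1, Sub Z v → Mem (node 4 X Z) s → Agree v p Z s t

/-- Coded version of `LUD.KRel`. -/
def KRel (v p X s t : ℕ) : Prop :=
  ∀ Z < v + 1, Sub Z v → Mem (node 6 X Z) s → Inherit v p Z s t

/-- Coded version of `LUD.DepLike`, for the dependence atoms with the tag `k` in `s`. -/
def DepLike (v k s : ℕ) : Prop :=
  (∀ X < v + 1, Sub X v → ∀ Y < v + 1, Sub Y v →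
    (Mem (node k X Y) s ↔ ∀ y < Y, Mem y Y → Mem (node k X (2 ^ y)) s)) ∧
  (∀ X < v + 1, Sub X v → ∀ x < X, Mem x X → Mem (node k X (2 ^ x)) s) ∧
  (∀ X < v + 1, Sub X v → ∀ Y < v + 1, Sub Y v → ∀ Z < v + 1, Sub Z v →
    Mem (node k X Y) s → Mem (node k Y Z) s → Mem (node k X Z) s)

/-- Coded version of `LUD.SubClosed`. -/
def SubClosed (v p : ℕ) : Prop :=
  (∀ P < p, ∀ l < p, Mem (node 0 P l) p → ∀ y ∈ list l, Mem y v) ∧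
  (∀ c < p, Mem (Nat.pair 1 c) p → Mem c p) ∧
  (∀ c < p, ∀ d < p, Mem (node 2 c d) p → Mem c p ∧ Mem d p) ∧
  (∀ X < p, ∀ c < p, Mem (node 3 X c) p → Sub X v ∧ Mem c p) ∧
  (∀ X < p, ∀ Y < p, Mem (node 4 X Y) p → Sub X v ∧ Sub Y v) ∧
  (∀ X < p, ∀ c < p, Mem (node 5 X c) p → Sub X v ∧ Mem c p) ∧
  (∀ X < p, ∀ Y < p, Mem (node 6 X Y) p → Sub X v ∧ Sub Y v) ∧
  (∀ X < p, ∀ Y < p, Mem (node 7 X Y) p → Sub X v ∧ Sub Y v)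

/-- Coded version of `LUD.IsType`. -/
def IsType (v p s : ℕ) : Prop :=
  (∀ c < p, Mem (Nat.pair 1 c) p → (Mem (Nat.pair 1 c) s ↔ ¬ Mem c s)) ∧
  (∀ c < p, ∀ d < p, Mem (node 2 c d) p → (Mem (node 2 c d) s ↔ Mem c s ∧ Mem d s)) ∧
  (∀ X < p, ∀ c < p, Mem (node 3 X c) p → Mem (node 3 X c) s → Mem c s) ∧
  (∀ X < p, ∀ c < p, Mem (node 5 X c) p → Mem (node 5 X c) s → Mem c s) ∧
  DepLike v 4 s ∧ DepLike v 6 s ∧ DepLike v 7 s ∧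
  (∀ X < v + 1, Sub X v → ∀ Y < v + 1, Sub Y v → Mem (node 6 X Y) s → Mem (node 4 X Y) s) ∧
  (∀ X < v + 1, Sub X v → ∀ Y < v + 1, Sub Y v → Mem (node 7 X Y) s → Mem (node 6 X Y) s) ∧
  (∀ X < v + 1, Sub X v → ∀ Y < v + 1, Sub Y v → Mem (node 4 0 Y) s → Mem (node 7 X Y) s)

/-- Coded version of `LUD.QuasiModel`. -/
def QuasiModel (v p w : ℕ) : Prop :=
  SubClosed v p ∧ (∀ s < w, Mem s w → IsType v p s) ∧
  (∀ s < w, Mem s w → ∀ X < p, ∀ c < p, Mem (node 3 X c) p → ¬ Mem (node 3 X c) s →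
    ∃ t < w, Mem t w ∧ DRel v p X s t ∧ ¬ Mem c t) ∧
  (∀ s < w, Mem s w → ∀ X < p, ∀ c < p, Mem (node 5 X c) p → ¬ Mem (node 5 X c) s →
    ∃ t < w, Mem t w ∧ KRel v p X s t ∧ ¬ Mem c t) ∧
  (∀ s < w, Mem s w → ∀ t < w, Mem t w → DRel v p 0 s t) ∧
  (∀ s < w, Mem s w → ∀ t < w, Mem t w → ∀ X < v + 1, Sub X v → ∀ Y < v + 1, Sub Y v →
    Mem (node 7 X Y) s → Mem (node 7 X Y) t)

/-- The numbers `v` and `p` code the variables and the subformulas of the formula with the Gödel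
number `n`. Minimality keeps out numbers that code no variable and no formula, without deciding
which numbers do. -/
def IsClosure (n v p : ℕ) : Prop :=
  Mem n p ∧ SubClosed v p ∧
    ∀ v' < v + 1, ∀ p' < p + 1, Mem n p' → SubClosed v' p' → v' = v ∧ p' = p

/-- A bound for the Gödel numbers of the subformulas of the formula with the Gödel number `n` and of
the dependence atoms over its variables. -/
def bound (n : ℕ) : ℕ := n + 1 + node 8 (2 ^ n) (2 ^ n)

/-- The formula with the Gödel number `n` is refuted by a quasi-model of bounded size. -/
def Refutable (n : ℕ) : Prop :=
  ∃ v < 2 ^ n, ∃ p < 2 ^ (n + 1), IsClosure n v p ∧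
    ∃ w < 2 ^ 2 ^ bound n, QuasiModel v p w ∧ ∃ s < w, Mem s w ∧ ¬ Mem n s

section Primrec

variable {α : Type} [Primcodable α] {p q : α → Prop} {R : α → ℕ → Prop} {f g h : α → ℕ}

theorem primrec_id' : Primrec fun a : α => a := .id

theorem primrec_pow (hf : Primrec f) (hg : Primrec g) : Primrec fun a => f a ^ g a :=
  (Primrec₂.unpaired'.1 Nat.Primrec.pow : Primrec₂ ((· ^ ·) : ℕ → ℕ → ℕ)).comp hf hg

theorem primrec_node (hf : Primrec f) (hg : Primrec g) (hh : Primrec h) :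
    Primrec fun a => node (f a) (g a) (h a) :=
  Primrec₂.natPair.comp hf (Primrec₂.natPair.comp hg hh)

theorem primrec_bound (hf : Primrec f) : Primrec fun a => bound (f a) :=
  Primrec.nat_add.comp (Primrec.succ.comp hf)
    (primrec_node (.const 8) (primrec_pow (.const 2) hf) (primrec_pow (.const 2) hf))

theorem primrecPred_mem (hf : Primrec f) (hg : Primrec g) :
    PrimrecPred fun a => Mem (f a) (g a) := by
  have h : PrimrecPred fun a => g a / 2 ^ f a % 2 = 1 :=
    Primrec.eq.comp (Primrec.nat_mod.comp (Primrec.nat_div.comp hg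
      (primrec_pow (.const 2) hf)) (.const 2)) (.const 1)
  exact h.of_eq fun a => by simp [Mem, Nat.testBit_eq_decide_div_mod_eq]

theorem primrecPred_imp (hp : PrimrecPred p) (hq : PrimrecPred q) :
    PrimrecPred fun a => p a → q a := by
  classical
  exact (hp.not.or hq).of_eq fun a => imp_iff_not_or.symm

theorem primrecPred_iff (hp : PrimrecPred p) (hq : PrimrecPred q) :
    PrimrecPred fun a => p a ↔ q a :=
  ((primrecPred_imp hp hq).and (primrecPred_imp hq hp)).of_eq fun _ =>
    iff_iff_implies_and_implies.symm

theorem primrecPred_forall_lt (hf : Primrec f) (hR : PrimrecPred fun q : α × ℕ => R q.1 q.2) :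
    PrimrecPred fun a => ∀ x < f a, R a x := by
  have h : PrimrecRel fun (x : ℕ) (a : α) => R a x := hR.primrecRel.swap
  exact (h.forall_mem_list.comp (Primrec.list_range.comp hf) .id).of_eq (by simp)

theorem primrecPred_exists_lt (hf : Primrec f) (hR : PrimrecPred fun q : α × ℕ => R q.1 q.2) :
    PrimrecPred fun a => ∃ x < f a, R a x := by
  have h : PrimrecRel fun (x : ℕ) (a : α) => R a x := hR.primrecRel.swap
  exact (h.exists_mem_list.comp (Primrec.list_range.comp hf) .id).of_eq (by simp)

theorem primrecPred_forall_mem_list (hf : Primrec f)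
    (hR : PrimrecPred fun q : α × ℕ => R q.1 q.2) : PrimrecPred fun a => ∀ x ∈ list (f a), R a x :=
  (PrimrecRel.forall_mem_list (R := fun x a => R a x) hR.primrecRel.swap).comp
    (Primrec.option_getD.comp (Primrec.decode.comp hf) (.const [])) .id

theorem primrecPred_sub (hf : Primrec f) (hg : Primrec g) :
    PrimrecPred fun a => Sub (f a) (g a) :=
  primrecPred_forall_lt hf (primrecPred_imp (primrecPred_mem .snd (hf.comp .fst))
    (primrecPred_mem .snd (hg.comp .fst)))

theorem primrecPred_refutable : PrimrecPred Refutable := by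
  change PrimrecPred fun n => Refutable n
  unfold Refutable IsClosure QuasiModel IsType SubClosed DepLike KRel DRel Inherit Agree
  repeat' with_reducible first
    | exact primrec_id'
    | exact Primrec.const _
    | exact Primrec.fst
    | exact Primrec.snd
    | apply primrecPred_exists_lt
    | apply primrecPred_forall_lt
    | apply primrecPred_forall_mem_list
    | apply primrecPred_mem
    | apply primrecPred_sub
    | apply PrimrecPred.not
    | apply PrimrecPred.and
    | apply primrecPred_iff
    | apply primrecPred_imp
    | apply primrec_node
    | apply primrec_bound
    | apply primrec_pow
    | refine Primrec.eq.comp ?_ ?_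
    | refine Primrec₂.natPair.comp ?_ ?_
    | refine Primrec.succ.comp ?_
    | refine Primrec.nat_add.comp ?_ ?_
    | refine Primrec.fst.comp ?_
    | refine Primrec.snd.comp ?_

end Primrec

theorem Mem.lt {i m : ℕ} (h : Mem i m) : i < m :=
  Nat.lt_two_pow_self.trans_le (Nat.ge_two_pow_of_testBit h)

theorem ext {m n : ℕ} (h : ∀ i, Mem i m ↔ Mem i n) : m = n :=
  Nat.eq_of_testBit_eq fun i => Bool.eq_iff_iff.2 (h i)

theorem mem_sum_two_pow {I : Finset ℕ} {i : ℕ} : Mem i (∑ j ∈ I, 2 ^ j) ↔ i ∈ I := by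
  rw [Mem, ← Nat.mem_bitIndices, ← List.mem_toFinset, Finset.toFinset_bitIndices_sum_two_pow]

theorem exists_lt_forall_mem_iff (B : ℕ) (I : Set ℕ) :
    ∃ m < 2 ^ B, ∀ i, Mem i m ↔ i < B ∧ i ∈ I := by
  classical
  refine ⟨∑ i ∈ (Finset.range B).filter (· ∈ I), 2 ^ i, ?_, fun i => ?_⟩
  · exact Nat.geomSum_lt le_rfl fun i hi => by simpa using (Finset.mem_filter.1 hi).1
  · simp [mem_sum_two_pow]

theorem sub_iff {X v : ℕ} : Sub X v ↔ ∀ i, Mem i X → Mem i v :=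
  ⟨fun h i hi => h i hi.lt hi, fun h i _ => h i⟩

theorem Sub.le {X v : ℕ} (h : Sub X v) : X ≤ v := by
  have : X = X &&& v := ext fun i => by
    have := sub_iff.1 h i
    simp only [Mem, Nat.testBit_and, Bool.and_eq_true] at this ⊢
    tauto
  rw [this]
  exact Nat.and_le_right

theorem node_lt {k X Y m : ℕ} (h : Mem (node k X Y) m) : X < m ∧ Y < m :=
  ⟨(Nat.left_le_pair X Y).trans_lt ((Nat.right_le_pair k _).trans_lt h.lt),
    (Nat.right_le_pair X Y).trans_lt ((Nat.right_le_pair k _).trans_lt h.lt)⟩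

theorem pair_lt {k c m : ℕ} (h : Mem (Nat.pair k c) m) : c < m :=
  (Nat.right_le_pair k c).trans_lt h.lt

theorem node_lt_node {k k' X X' Y Y' : ℕ} (hk : k < k') (hX : X < X') (hY : Y < Y') :
    node k X Y < node k' X' Y' :=
  (Nat.pair_lt_pair_left _ hk).trans (Nat.pair_lt_pair_right _
    ((Nat.pair_lt_pair_left _ hX).trans (Nat.pair_lt_pair_right _ hY)))

theorem list_encode (l : List ℕ) : list (Encodable.encode l) = l := by
  simp [list]

theorem lt_encode_of_mem_list {l : List ℕ} {y : ℕ} (h : y ∈ l) : y < Encodable.encode l := by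
  induction l with
  | nil => simp at h
  | cons a l ih =>
    rw [Encodable.encode_list_cons]
    rcases List.mem_cons.1 h with rfl | h
    · exact Nat.lt_succ_of_le (Nat.left_le_pair _ _)
    · exact (ih h).trans_le ((Nat.right_le_pair _ _).trans (Nat.le_succ _))

/-! ### Gödel numbers -/

section GodelNumbers

variable {Var Pred : Type u} [Encodable Var]

theorem mem_codeSet {X : Finset Var} {i : ℕ} :
    Mem i (codeSet X) ↔ ∃ x ∈ X, Encodable.encode x = i := by
  have : codeSet X = ∑ n ∈ X.map ⟨Encodable.encode, Encodable.encode_injective⟩, 2 ^ n := by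
    simp [codeSet]
  rw [this, mem_sum_two_pow]
  simp

theorem encode_mem_codeSet {X : Finset Var} {x : Var} :
    Mem (Encodable.encode x) (codeSet X) ↔ x ∈ X := by
  simp [mem_codeSet]

theorem codeSet_singleton (x : Var) : codeSet {x} = 2 ^ Encodable.encode x := by
  simp [codeSet]

theorem codeSet_empty : codeSet (∅ : Finset Var) = 0 := by
  simp [codeSet]

theorem sub_codeSet_iff {X Y : Finset Var} : Sub (codeSet X) (codeSet Y) ↔ X ⊆ Y := by
  simp only [sub_iff, mem_codeSet, forall_exists_index, and_imp, forall_apply_eq_imp_iff₂,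
    Encodable.encode_inj, exists_eq_right, Finset.subset_iff]

theorem exists_codeSet_eq_of_sub {V : Finset Var} {X : ℕ} (h : Sub X (codeSet V)) :
    ∃ Y ⊆ V, codeSet Y = X := by
  classical
  refine ⟨V.filter fun x => Mem (Encodable.encode x) X, Finset.filter_subset _ _, ext fun i => ?_⟩
  simp only [mem_codeSet, Finset.mem_filter]
  constructor
  · rintro ⟨x, ⟨-, hx⟩, rfl⟩
    exact hx
  · intro hi
    obtain ⟨x, hx, rfl⟩ := mem_codeSet.1 (sub_iff.1 h i hi)
    exact ⟨x, ⟨hx, hi⟩, rfl⟩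

variable [Encodable Pred] {ar : Pred → ℕ} {φ ψ : Formula Var ar}

theorem code_le_of_mem_subformulas (h : ψ ∈ φ.subformulas) : ψ.code ≤ φ.code := by
  induction φ with
  | pred | Dep | KDep | UDep => rw [Set.mem_singleton_iff.1 h]
  | neg φ ih =>
    rcases h with rfl | h
    · exact le_rfl
    · exact (ih h).trans (Nat.right_le_pair _ _)
  | and φ χ ih₁ ih₂ =>
    rcases h with rfl | h | h
    · exact le_rfl
    · exact (ih₁ h).trans ((Nat.left_le_pair _ _).trans (Nat.right_le_pair _ _))
    · exact (ih₂ h).trans ((Nat.right_le_pair _ _).trans (Nat.right_le_pair _ _))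
  | D _ φ ih | K _ φ ih =>
    rcases h with rfl | h
    · exact le_rfl
    · exact (ih h).trans ((Nat.right_le_pair _ _).trans (Nat.right_le_pair _ _))

theorem encode_lt_code_of_mem_vars [DecidableEq Var] {x : Var} (h : x ∈ φ.vars) :
    Encodable.encode x < φ.code := by
  have lt_left {X : Finset Var} (h : x ∈ X) (k Y : ℕ) :
      Encodable.encode x < Nat.pair k (Nat.pair (codeSet X) Y) :=
    (encode_mem_codeSet.2 h).lt.trans_le ((Nat.left_le_pair _ _).trans (Nat.right_le_pair _ _))
  have lt_right {n : ℕ} (h : Encodable.encode x < n) (k Y : ℕ) :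
      Encodable.encode x < Nat.pair k (Nat.pair Y n) :=
    h.trans_le ((Nat.right_le_pair _ _).trans (Nat.right_le_pair _ _))
  induction φ with
  | pred P xs =>
    obtain ⟨i, -, rfl⟩ := Finset.mem_image.1 h
    exact lt_right (lt_encode_of_mem_list (List.mem_ofFn.2 ⟨i, rfl⟩)) _ _
  | neg φ ih => exact (ih h).trans_le (Nat.right_le_pair _ _)
  | and φ χ ih₁ ih₂ =>
    rcases Finset.mem_union.1 h with h | h
    · exact (ih₁ h).trans_le ((Nat.left_le_pair _ _).trans (Nat.right_le_pair _ _))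
    · exact lt_right (ih₂ h) _ _
  | D X φ ih | K X φ ih =>
    rcases Finset.mem_union.1 h with h | h
    · exact lt_left h _ _
    · exact lt_right (ih h) _ _
  | Dep X Y | KDep X Y | UDep X Y =>
    rcases Finset.mem_union.1 h with h | h
    · exact lt_left h _ _
    · exact lt_right (encode_mem_codeSet.2 h).lt _ _

theorem codeSet_lt_of_subset_vars [DecidableEq Var] {X : Finset Var} (h : X ⊆ φ.vars) :
    codeSet X < 2 ^ φ.code := by
  refine Nat.lt_pow_two_of_testBit _ fun i hi => Bool.eq_false_iff.2 fun hX => ?_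
  obtain ⟨x, hx, rfl⟩ := mem_codeSet.1 hX
  exact hi.not_gt (encode_lt_code_of_mem_vars (h hx))

theorem node_codeSet_lt_bound [DecidableEq Var] {X Y : Finset Var} (hX : X ⊆ φ.vars)
    (hY : Y ⊆ φ.vars) {k : ℕ} (hk : k < 8) :
    node k (codeSet X) (codeSet Y) < bound φ.code :=
  (node_lt_node hk (codeSet_lt_of_subset_vars hX) (codeSet_lt_of_subset_vars hY)).trans_le
    (Nat.le_add_left _ _)

theorem code_lt_bound (h : ψ ∈ φ.subformulas) : ψ.code < bound φ.code :=
  (Nat.lt_succ_of_le (code_le_of_mem_subformulas h)).trans_le (Nat.le_add_right _ _)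

theorem code_pred (P : Pred) (xs : Fin (ar P) → Var) : (pred P xs).code = node 0
    (Encodable.encode P) (Encodable.encode (List.ofFn fun i => Encodable.encode (xs i))) := rfl

theorem code_D (X : Finset Var) : (D X φ).code = node 3 (codeSet X) φ.code := rfl

theorem code_K (X : Finset Var) : (K X φ).code = node 5 (codeSet X) φ.code := rfl

end GodelNumbers

/-! ### Correctness of the coding -/

section Translation

variable {Var Pred : Type u} [Encodable Var] {V : Finset Var}

theorem forall_sub_codeSet_iff {P : ℕ → Prop} :
    (∀ X < codeSet V + 1, Sub X (codeSet V) → P X) ↔ ∀ X ⊆ V, P (codeSet X) := by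
  constructor
  · exact fun h X hX => h _ (Nat.lt_succ_of_le (sub_codeSet_iff.2 hX).le) (sub_codeSet_iff.2 hX)
  · intro h X _ hX
    obtain ⟨X, hXV, rfl⟩ := exists_codeSet_eq_of_sub hX
    exact h X hXV

theorem forall_mem_codeSet_iff {P : ℕ → Prop} :
    (∀ x < codeSet V, Mem x (codeSet V) → P x) ↔ ∀ x ∈ V, P (Encodable.encode x) := by
  constructor
  · exact fun h x hx => h _ (encode_mem_codeSet.2 hx).lt (encode_mem_codeSet.2 hx)
  · intro h x _ hx
    obtain ⟨x, hxV, rfl⟩ := mem_codeSet.1 hx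
    exact h x hxV

variable [Encodable Pred] {ar : Pred → ℕ} {Φ : Set (Formula Var ar)} {p : ℕ}

/-- The set of formulas `Φ` is coded by the set of its Gödel numbers. -/
def CodesFormulas (Φ : Set (Formula Var ar)) (p : ℕ) : Prop :=
  ∀ i, Mem i p ↔ ∃ ψ ∈ Φ, ψ.code = i

namespace CodesFormulas

variable (hp : CodesFormulas Φ p)
include hp

theorem mem_code_iff {ψ : Formula Var ar} : Mem ψ.code p ↔ ψ ∈ Φ := by
  rw [hp]
  exact ⟨fun ⟨χ, hχ, h⟩ => code_injective h ▸ hχ, fun h => ⟨ψ, h, rfl⟩⟩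

theorem forall_node_iff {k : ℕ} {P : ℕ → ℕ → Prop} :
    (∀ X < p, ∀ Y < p, Mem (node k X Y) p → P X Y) ↔
      ∀ ψ ∈ Φ, ∀ X Y, ψ.code = node k X Y → P X Y := by
  constructor
  · intro h ψ hψ X Y he
    have hm : Mem (node k X Y) p := he ▸ hp.mem_code_iff.2 hψ
    exact h X (node_lt hm).1 Y (node_lt hm).2 hm
  · intro h X _ Y _ hm
    obtain ⟨ψ, hψ, he⟩ := (hp _).1 hm
    exact h ψ hψ X Y he

theorem forall_pred_iff {P : ℕ → ℕ → Prop} :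
    (∀ Q < p, ∀ l < p, Mem (node 0 Q l) p → P Q l) ↔ ∀ Q xs, pred Q xs ∈ Φ →
      P (Encodable.encode Q) (Encodable.encode (List.ofFn fun i => Encodable.encode (xs i))) := by
  rw [hp.forall_node_iff]
  refine ⟨fun h _ _ hψ => h _ hψ _ _ rfl, fun h ψ hψ _ _ he => ?_⟩
  cases ψ <;> simp only [code, node, Nat.pair_eq_pair] at he <;> try omega
  obtain ⟨-, rfl, rfl⟩ := he
  exact h _ _ hψ

theorem forall_neg_iff {P : ℕ → Prop} :
    (∀ c < p, Mem (Nat.pair 1 c) p → P c) ↔ ∀ ψ, neg ψ ∈ Φ → P ψ.code := by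
  constructor
  · intro h ψ hψ
    have hm := hp.mem_code_iff.2 hψ
    exact h _ (pair_lt hm) hm
  · intro h c _ hm
    obtain ⟨ψ, hψ, he⟩ := (hp _).1 hm
    cases ψ <;> simp only [code, Nat.pair_eq_pair] at he <;> try omega
    obtain ⟨-, rfl⟩ := he
    exact h _ hψ

theorem forall_and_iff {P : ℕ → ℕ → Prop} :
    (∀ c < p, ∀ d < p, Mem (node 2 c d) p → P c d) ↔
      ∀ ψ χ, Formula.and ψ χ ∈ Φ → P ψ.code χ.code := by
  rw [hp.forall_node_iff]
  refine ⟨fun h _ _ hψ => h _ hψ _ _ rfl, fun h ψ hψ _ _ he => ?_⟩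
  cases ψ <;> simp only [code, node, Nat.pair_eq_pair] at he <;> try omega
  obtain ⟨-, rfl, rfl⟩ := he
  exact h _ _ hψ

theorem forall_D_iff {P : ℕ → ℕ → Prop} :
    (∀ X < p, ∀ c < p, Mem (node 3 X c) p → P X c) ↔
      ∀ X ψ, D X ψ ∈ Φ → P (codeSet X) ψ.code := by
  rw [hp.forall_node_iff]
  refine ⟨fun h _ _ hψ => h _ hψ _ _ rfl, fun h ψ hψ _ _ he => ?_⟩
  cases ψ <;> simp only [code, node, Nat.pair_eq_pair] at he <;> try omega
  obtain ⟨-, rfl, rfl⟩ := he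
  exact h _ _ hψ

theorem forall_D_codeSet_iff {Z : Finset Var} {P : ℕ → Prop} :
    (∀ c < p, Mem (node 3 (codeSet Z) c) p → P c) ↔ ∀ ψ, D Z ψ ∈ Φ → P ψ.code := by
  constructor
  · intro h ψ hψ
    have hm := hp.mem_code_iff.2 hψ
    exact h _ (node_lt hm).2 hm
  · intro h c hc hm
    exact hp.forall_D_iff (P := fun X c => X = codeSet Z → P c).2
      (fun X ψ hψ hX => h ψ (codeSet_injective hX ▸ hψ)) _ (node_lt hm).1 c hc hm rfl

theorem forall_Dep_iff {P : ℕ → ℕ → Prop} :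
    (∀ X < p, ∀ Y < p, Mem (node 4 X Y) p → P X Y) ↔
      ∀ X Y, Dep X Y ∈ Φ → P (codeSet X) (codeSet Y) := by
  rw [hp.forall_node_iff]
  refine ⟨fun h _ _ hψ => h _ hψ _ _ rfl, fun h ψ hψ _ _ he => ?_⟩
  cases ψ <;> simp only [code, node, Nat.pair_eq_pair] at he <;> try omega
  obtain ⟨-, rfl, rfl⟩ := he
  exact h _ _ hψ

theorem forall_K_iff {P : ℕ → ℕ → Prop} :
    (∀ X < p, ∀ c < p, Mem (node 5 X c) p → P X c) ↔
      ∀ X ψ, K X ψ ∈ Φ → P (codeSet X) ψ.code := by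
  rw [hp.forall_node_iff]
  refine ⟨fun h _ _ hψ => h _ hψ _ _ rfl, fun h ψ hψ _ _ he => ?_⟩
  cases ψ <;> simp only [code, node, Nat.pair_eq_pair] at he <;> try omega
  obtain ⟨-, rfl, rfl⟩ := he
  exact h _ _ hψ

theorem forall_K_codeSet_iff {Z : Finset Var} {P : ℕ → Prop} :
    (∀ c < p, Mem (node 5 (codeSet Z) c) p → P c) ↔ ∀ ψ, K Z ψ ∈ Φ → P ψ.code := by
  constructor
  · intro h ψ hψ
    have hm := hp.mem_code_iff.2 hψ
    exact h _ (node_lt hm).2 hm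
  · intro h c hc hm
    exact hp.forall_K_iff (P := fun X c => X = codeSet Z → P c).2
      (fun X ψ hψ hX => h ψ (codeSet_injective hX ▸ hψ)) _ (node_lt hm).1 c hc hm rfl

theorem forall_KDep_iff {P : ℕ → ℕ → Prop} :
    (∀ X < p, ∀ Y < p, Mem (node 6 X Y) p → P X Y) ↔
      ∀ X Y, KDep X Y ∈ Φ → P (codeSet X) (codeSet Y) := by
  rw [hp.forall_node_iff]
  refine ⟨fun h _ _ hψ => h _ hψ _ _ rfl, fun h ψ hψ _ _ he => ?_⟩
  cases ψ <;> simp only [code, node, Nat.pair_eq_pair] at he <;> try omega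
  obtain ⟨-, rfl, rfl⟩ := he
  exact h _ _ hψ

theorem forall_UDep_iff {P : ℕ → ℕ → Prop} :
    (∀ X < p, ∀ Y < p, Mem (node 7 X Y) p → P X Y) ↔
      ∀ X Y, UDep X Y ∈ Φ → P (codeSet X) (codeSet Y) := by
  rw [hp.forall_node_iff]
  refine ⟨fun h _ _ hψ => h _ hψ _ _ rfl, fun h ψ hψ _ _ he => ?_⟩
  cases ψ <;> simp only [code, node, Nat.pair_eq_pair] at he <;> try omega
  obtain ⟨-, rfl, rfl⟩ := he
  exact h _ _ hψ

theorem subClosed_iff : SubClosed (codeSet V) p ↔ LUD.SubClosed V Φ := by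
  simp only [SubClosed, hp.forall_pred_iff, hp.forall_neg_iff, hp.forall_and_iff, hp.forall_D_iff,
    hp.forall_Dep_iff, hp.forall_K_iff, hp.forall_KDep_iff, hp.forall_UDep_iff, sub_codeSet_iff,
    hp.mem_code_iff, list_encode, List.forall_mem_ofFn_iff, encode_mem_codeSet]
  exact ⟨fun ⟨h₁, h₂, h₃, h₄, h₅, h₆, h₇, h₈⟩ => ⟨h₁, h₂, h₃, h₄, h₅, h₆, h₇, h₈⟩,
    fun ⟨h₁, h₂, h₃, h₄, h₅, h₆, h₇, h₈⟩ => ⟨h₁, h₂, h₃, h₄, h₅, h₆, h₇, h₈⟩⟩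

end CodesFormulas

/-- The number `s` codes the type `σ` as far as the formulas in `Φ` and the dependence atoms over
`V` are concerned. -/
structure CodesType (V : Finset Var) (Φ : Set (Formula Var ar)) (s : ℕ)
    (σ : Set (Formula Var ar)) : Prop where
  mem : ∀ ψ ∈ Φ, Mem ψ.code s ↔ ψ ∈ σ
  dep : ∀ X ⊆ V, ∀ Y ⊆ V, Mem (node 4 (codeSet X) (codeSet Y)) s ↔ Dep X Y ∈ σ
  kdep : ∀ X ⊆ V, ∀ Y ⊆ V, Mem (node 6 (codeSet X) (codeSet Y)) s ↔ KDep X Y ∈ σ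
  udep : ∀ X ⊆ V, ∀ Y ⊆ V, Mem (node 7 (codeSet X) (codeSet Y)) s ↔ UDep X Y ∈ σ

theorem depLike_iff {k s : ℕ} {R : Finset Var → Finset Var → Prop}
    (hR : ∀ X ⊆ V, ∀ Y ⊆ V, Mem (node k (codeSet X) (codeSet Y)) s ↔ R X Y) :
    DepLike (codeSet V) k s ↔ LUD.DepLike V R := by
  have hR' (X : Finset Var) (hX : X ⊆ V) (Y : Finset Var) (hY : Y ⊆ V) :
      (∀ y ∈ Y, Mem (node k (codeSet X) (2 ^ Encodable.encode y)) s) ↔ ∀ y ∈ Y, R X {y} :=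
    forall₂_congr fun y hy => by
      rw [← codeSet_singleton, hR X hX _ (Finset.singleton_subset_iff.2 (hY hy))]
  simp +contextual only [DepLike, forall_sub_codeSet_iff, forall_mem_codeSet_iff, hR, hR']
  exact ⟨fun ⟨h₁, h₂, h₃⟩ => ⟨h₁, h₂, h₃⟩, fun ⟨h₁, h₂, h₃⟩ => ⟨h₁, h₂, h₃⟩⟩

namespace CodesType

variable {s t : ℕ} {σ τ : Set (Formula Var ar)} (hp : CodesFormulas Φ p)
  (hs : CodesType V Φ s σ) (ht : CodesType V Φ t τ)
include hp hs

theorem isType_iff (hΦ : LUD.SubClosed V Φ) : IsType (codeSet V) p s ↔ LUD.IsType V Φ σ := by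
  have hd₀ (Y : Finset Var) (hY : Y ⊆ V) : Mem (node 4 0 (codeSet Y)) s ↔ Dep ∅ Y ∈ σ := by
    rw [← hs.dep ∅ (Finset.empty_subset V) Y hY, codeSet_empty]
  simp +contextual only [IsType, hp.forall_neg_iff, hp.forall_and_iff, hp.forall_D_iff,
    hp.forall_K_iff, depLike_iff hs.dep, depLike_iff hs.kdep, depLike_iff hs.udep,
    forall_sub_codeSet_iff, hs.dep, hs.kdep, hs.udep, hd₀]
  refine Iff.trans (and_congr (forall₂_congr fun ψ hψ => iff_congr (hs.mem _ hψ)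
      (not_congr (hs.mem ψ (hΦ.neg ψ hψ))))
    (and_congr (forall₃_congr fun ψ χ hψ => iff_congr (hs.mem _ hψ)
      (and_congr (hs.mem ψ (hΦ.and ψ χ hψ).1) (hs.mem χ (hΦ.and ψ χ hψ).2)))
    (and_congr (forall₃_congr fun X ψ hψ => imp_congr (hs.mem _ hψ) (hs.mem ψ (hΦ.d X ψ hψ).2))
    (and_congr (forall₃_congr fun X ψ hψ => imp_congr (hs.mem _ hψ) (hs.mem ψ (hΦ.k X ψ hψ).2))
    Iff.rfl)))) ?_
  exact ⟨fun ⟨h₁, h₂, h₃, h₄, h₅, h₆, h₇, h₈, h₉, h₁₀⟩ => ⟨h₁, h₂, h₃, h₄, h₅, h₆, h₇, h₈, h₉, h₁₀⟩,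
    fun ⟨h₁, h₂, h₃, h₄, h₅, h₆, h₇, h₈, h₉, h₁₀⟩ => ⟨h₁, h₂, h₃, h₄, h₅, h₆, h₇, h₈, h₉, h₁₀⟩⟩

include ht

theorem agree_iff {Z : Finset Var} (hZ : Z ⊆ V) :
    Agree (codeSet V) p (codeSet Z) s t ↔ LUD.Agree V Φ Z σ τ := by
  simp +contextual only [Agree, forall_sub_codeSet_iff, hp.forall_D_codeSet_iff,
    hp.forall_K_codeSet_iff, hp.forall_pred_iff, hs.dep Z hZ, ht.dep Z hZ, hs.kdep Z hZ,
    ht.kdep Z hZ, list_encode, List.forall_mem_ofFn_iff, encode_mem_codeSet, ← code_pred, ← code_D,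
    ← code_K, hs.mem, ht.mem]
  exact ⟨fun ⟨h₁, h₂, h₃, h₄, h₅⟩ => ⟨h₁, h₂, h₃, h₄, h₅⟩,
    fun ⟨h₁, h₂, h₃, h₄, h₅⟩ => ⟨h₁, h₂, h₃, h₄, h₅⟩⟩

theorem inherit_iff {Z : Finset Var} (hZ : Z ⊆ V) :
    Inherit (codeSet V) p (codeSet Z) s t ↔ LUD.Inherit V Φ Z σ τ := by
  simp +contextual only [Inherit, forall_sub_codeSet_iff, hp.forall_K_codeSet_iff, hs.kdep Z hZ,
    ht.kdep Z hZ, ← code_K, hs.mem, ht.mem]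
  exact ⟨fun ⟨h₁, h₂⟩ => ⟨h₁, h₂⟩, fun ⟨h₁, h₂⟩ => ⟨h₁, h₂⟩⟩

theorem dRel_iff {X : Finset Var} (hX : X ⊆ V) :
    DRel (codeSet V) p (codeSet X) s t ↔ LUD.DRel V Φ X σ τ :=
  forall_sub_codeSet_iff.trans <| forall₂_congr fun Z hZ =>
    imp_congr (hs.dep X hX Z hZ) (agree_iff hp hs ht hZ)

theorem kRel_iff {X : Finset Var} (hX : X ⊆ V) :
    KRel (codeSet V) p (codeSet X) s t ↔ LUD.KRel V Φ X σ τ :=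
  forall_sub_codeSet_iff.trans <| forall₂_congr fun Z hZ =>
    imp_congr (hs.kdep X hX Z hZ) (inherit_iff hp hs ht hZ)

theorem dRel_zero_iff : DRel (codeSet V) p 0 s t ↔ LUD.DRel V Φ ∅ σ τ := by
  rw [← dRel_iff hp hs ht (Finset.empty_subset V), codeSet_empty]

end CodesType

/-- Every member of `w` codes a type in `W`, and every type in `W` is coded by a member of `w`. -/
structure CodesTypes (V : Finset Var) (Φ : Set (Formula Var ar)) (w : ℕ)
    (W : Set (Set (Formula Var ar))) : Prop where
  exists_type : ∀ s, Mem s w → ∃ σ ∈ W, CodesType V Φ s σ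
  exists_code : ∀ σ ∈ W, ∃ s, Mem s w ∧ CodesType V Φ s σ

namespace CodesTypes

variable {w : ℕ} {W : Set (Set (Formula Var ar))} (hw : CodesTypes V Φ w W)
include hw

theorem forall_iff {P : ℕ → Prop} {Q : Set (Formula Var ar) → Prop}
    (h : ∀ s σ, CodesType V Φ s σ → (P s ↔ Q σ)) :
    (∀ s < w, Mem s w → P s) ↔ ∀ σ ∈ W, Q σ := by
  constructor
  · intro hP σ hσ
    obtain ⟨s, hs, hsσ⟩ := hw.exists_code σ hσ
    exact (h s σ hsσ).1 (hP s hs.lt hs)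
  · intro hQ s _ hs
    obtain ⟨σ, hσ, hsσ⟩ := hw.exists_type s hs
    exact (h s σ hsσ).2 (hQ σ hσ)

theorem exists_iff {P : ℕ → Prop} {Q : Set (Formula Var ar) → Prop}
    (h : ∀ s σ, CodesType V Φ s σ → (P s ↔ Q σ)) :
    (∃ s < w, Mem s w ∧ P s) ↔ ∃ σ ∈ W, Q σ := by
  simpa using not_congr (hw.forall_iff fun s σ hs => not_congr (h s σ hs))

theorem forall_D_iff (hp : CodesFormulas Φ p) (hΦ : LUD.SubClosed V Φ) :
    (∀ s < w, Mem s w → ∀ X < p, ∀ c < p, Mem (node 3 X c) p → ¬ Mem (node 3 X c) s →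
        ∃ t < w, Mem t w ∧ DRel (codeSet V) p X s t ∧ ¬ Mem c t) ↔
      ∀ σ ∈ W, ∀ X ψ, D X ψ ∈ Φ → D X ψ ∉ σ → ∃ τ ∈ W, LUD.DRel V Φ X σ τ ∧ ψ ∉ τ :=
  hw.forall_iff fun _ _ hs => hp.forall_D_iff.trans <| forall₃_congr fun X ψ hψ =>
    imp_congr (not_congr (hs.mem _ hψ)) <| hw.exists_iff fun _ _ ht =>
      and_congr (hs.dRel_iff hp ht (hΦ.d X ψ hψ).1) (not_congr (ht.mem ψ (hΦ.d X ψ hψ).2))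

theorem forall_K_iff (hp : CodesFormulas Φ p) (hΦ : LUD.SubClosed V Φ) :
    (∀ s < w, Mem s w → ∀ X < p, ∀ c < p, Mem (node 5 X c) p → ¬ Mem (node 5 X c) s →
        ∃ t < w, Mem t w ∧ KRel (codeSet V) p X s t ∧ ¬ Mem c t) ↔
      ∀ σ ∈ W, ∀ X ψ, K X ψ ∈ Φ → K X ψ ∉ σ → ∃ τ ∈ W, LUD.KRel V Φ X σ τ ∧ ψ ∉ τ :=
  hw.forall_iff fun _ _ hs => hp.forall_K_iff.trans <| forall₃_congr fun X ψ hψ =>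
    imp_congr (not_congr (hs.mem _ hψ)) <| hw.exists_iff fun _ _ ht =>
      and_congr (hs.kRel_iff hp ht (hΦ.k X ψ hψ).1) (not_congr (ht.mem ψ (hΦ.k X ψ hψ).2))

theorem quasiModel_iff (hp : CodesFormulas Φ p) :
    QuasiModel (codeSet V) p w ↔ LUD.QuasiModel V Φ W := by
  rw [QuasiModel, hp.subClosed_iff]
  refine Iff.trans (and_congr_right fun hΦ => and_congr
    (hw.forall_iff fun _ _ hs => hs.isType_iff hp hΦ)
    (and_congr (hw.forall_D_iff hp hΦ) (and_congr (hw.forall_K_iff hp hΦ) (and_congr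
      (hw.forall_iff fun _ _ hs => hw.forall_iff fun _ _ ht => hs.dRel_zero_iff hp ht)
      (hw.forall_iff fun _ _ hs => hw.forall_iff fun _ _ ht =>
        forall_sub_codeSet_iff.trans <| forall₂_congr fun X hX => forall_sub_codeSet_iff.trans <|
          forall₂_congr fun Y hY => imp_congr (hs.udep X hX Y hY) (ht.udep X hX Y hY)))))) ?_
  exact ⟨fun ⟨h₁, h₂, h₃, h₄, h₅, h₆⟩ => ⟨h₁, h₂, h₃, h₄, h₅, h₆⟩,
    fun ⟨h₁, h₂, h₃, h₄, h₅, h₆⟩ => ⟨h₁, h₂, h₃, h₄, h₅, h₆⟩⟩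

end CodesTypes

end Translation

/-! ### Decidability -/

section Decidability

variable {Var Pred : Type u} [Encodable Var] [Encodable Pred] {ar : Pred → ℕ}
  {φ : Formula Var ar} {v p : ℕ}

/-- The set of formulas whose Gödel numbers belong to the set of numbers coded by `m`. -/
def formulas (ar : Pred → ℕ) (m : ℕ) : Set (Formula Var ar) := {ψ | Mem ψ.code m}

theorem exists_codesFormulas (φ : Formula Var ar) :
    ∃ p < 2 ^ (φ.code + 1), CodesFormulas φ.subformulas p := by
  obtain ⟨p, hlt, hp⟩ :=
    exists_lt_forall_mem_iff (φ.code + 1) {i | ∃ ψ ∈ φ.subformulas, ψ.code = i}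
  refine ⟨p, hlt, fun i => (hp i).trans (and_iff_right_of_imp ?_)⟩
  rintro ⟨ψ, hψ, rfl⟩
  exact Nat.lt_succ_of_le (code_le_of_mem_subformulas hψ)

theorem codesType_formulas (V : Finset Var) (Φ : Set (Formula Var ar)) (s : ℕ) :
    CodesType V Φ s (formulas ar s) :=
  ⟨fun _ _ => .rfl, fun _ _ _ _ => .rfl, fun _ _ _ _ => .rfl, fun _ _ _ _ => .rfl⟩

theorem codesTypes_image_formulas (V : Finset Var) (Φ : Set (Formula Var ar)) (w : ℕ) :
    CodesTypes V Φ w (formulas ar '' {s | Mem s w}) where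
  exists_type s hs := ⟨_, ⟨s, hs, rfl⟩, codesType_formulas V Φ s⟩
  exists_code := by
    rintro _ ⟨s, hs, rfl⟩
    exact ⟨s, hs, codesType_formulas V Φ s⟩

variable [DecidableEq Var]

theorem sub_codeSet_union {X Y : Finset Var} (hX : Sub (codeSet X) v) (hY : Sub (codeSet Y) v) :
    Sub (codeSet (X ∪ Y)) v := by
  refine sub_iff.2 fun i hi => ?_
  obtain ⟨x, hx, rfl⟩ := mem_codeSet.1 hi
  rcases Finset.mem_union.1 hx with hx | hx
  · exact sub_iff.1 hX _ (encode_mem_codeSet.2 hx)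
  · exact sub_iff.1 hY _ (encode_mem_codeSet.2 hx)

theorem SubClosed.sub_and_forall_mem (hv : SubClosed v p) (hφ : Mem φ.code p) :
    Sub (codeSet φ.vars) v ∧ ∀ ψ ∈ φ.subformulas, Mem ψ.code p := by
  obtain ⟨hPred, hNeg, hAnd, hD, hDep, hK, hKDep, hUDep⟩ := hv
  induction φ with
  | pred P xs =>
    refine ⟨sub_iff.2 fun i hi => ?_, fun ψ hψ => Set.mem_singleton_iff.1 hψ ▸ hφ⟩
    obtain ⟨x, hx, rfl⟩ := mem_codeSet.1 hi
    obtain ⟨j, -, rfl⟩ := Finset.mem_image.1 hx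
    refine hPred _ (node_lt hφ).1 _ (node_lt hφ).2 hφ _ ?_
    rw [list_encode]
    exact List.mem_ofFn.2 ⟨j, rfl⟩
  | neg φ ih =>
    obtain ⟨hs, hm⟩ := ih (hNeg _ (pair_lt hφ) hφ)
    exact ⟨hs, Set.forall_mem_insert.2 ⟨hφ, hm⟩⟩
  | and φ χ ih₁ ih₂ =>
    obtain ⟨h₁, h₂⟩ := hAnd _ (node_lt hφ).1 _ (node_lt hφ).2 hφ
    exact ⟨sub_codeSet_union (ih₁ h₁).1 (ih₂ h₂).1, Set.forall_mem_insert.2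
      ⟨hφ, fun ψ hψ => hψ.elim ((ih₁ h₁).2 ψ) ((ih₂ h₂).2 ψ)⟩⟩
  | D X φ ih =>
    obtain ⟨hX, h⟩ := hD _ (node_lt hφ).1 _ (node_lt hφ).2 hφ
    exact ⟨sub_codeSet_union hX (ih h).1, Set.forall_mem_insert.2 ⟨hφ, (ih h).2⟩⟩
  | K X φ ih =>
    obtain ⟨hX, h⟩ := hK _ (node_lt hφ).1 _ (node_lt hφ).2 hφ
    exact ⟨sub_codeSet_union hX (ih h).1, Set.forall_mem_insert.2 ⟨hφ, (ih h).2⟩⟩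
  | Dep X Y =>
    obtain ⟨hX, hY⟩ := hDep _ (node_lt hφ).1 _ (node_lt hφ).2 hφ
    exact ⟨sub_codeSet_union hX hY, fun ψ hψ => Set.mem_singleton_iff.1 hψ ▸ hφ⟩
  | KDep X Y =>
    obtain ⟨hX, hY⟩ := hKDep _ (node_lt hφ).1 _ (node_lt hφ).2 hφ
    exact ⟨sub_codeSet_union hX hY, fun ψ hψ => Set.mem_singleton_iff.1 hψ ▸ hφ⟩
  | UDep X Y =>
    obtain ⟨hX, hY⟩ := hUDep _ (node_lt hφ).1 _ (node_lt hφ).2 hφ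
    exact ⟨sub_codeSet_union hX hY, fun ψ hψ => Set.mem_singleton_iff.1 hψ ▸ hφ⟩

theorem isClosure_iff :
    IsClosure φ.code v p ↔ v = codeSet φ.vars ∧ CodesFormulas φ.subformulas p := by
  have subClosed {q : ℕ} (hq : CodesFormulas φ.subformulas q) : SubClosed (codeSet φ.vars) q :=
    hq.subClosed_iff.2 φ.subClosed_subformulas
  have le_of_subClosed {q v' p' : ℕ} (hq : CodesFormulas φ.subformulas q) (hφ : Mem φ.code p')
      (hv' : SubClosed v' p') : codeSet φ.vars ≤ v' ∧ q ≤ p' := by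
    obtain ⟨hs, hm⟩ := hv'.sub_and_forall_mem hφ
    refine ⟨hs.le, Sub.le (sub_iff.2 fun i hi => ?_)⟩
    obtain ⟨ψ, hψ, rfl⟩ := (hq i).1 hi
    exact hm ψ hψ
  constructor
  · rintro ⟨hφ, hv, hmin⟩
    obtain ⟨q, -, hq⟩ := exists_codesFormulas φ
    obtain ⟨hvle, hqle⟩ := le_of_subClosed hq hφ hv
    obtain ⟨rfl, rfl⟩ := hmin _ (Nat.lt_succ_of_le hvle) _ (Nat.lt_succ_of_le hqle)
      (hq.mem_code_iff.2 φ.self_mem_subformulas) (subClosed hq)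
    exact ⟨rfl, hq⟩
  · rintro ⟨rfl, hp⟩
    refine ⟨hp.mem_code_iff.2 φ.self_mem_subformulas, subClosed hp, fun v' hv' p' hp' hφ hc => ?_⟩
    obtain ⟨hvle, hple⟩ := le_of_subClosed hp hφ hc
    exact ⟨(Nat.lt_succ_iff.1 hv').antisymm hvle, (Nat.lt_succ_iff.1 hp').antisymm hple⟩

theorem exists_codesType (φ : Formula Var ar) (σ : Set (Formula Var ar)) :
    ∃ s < 2 ^ bound φ.code, CodesType φ.vars φ.subformulas s σ := by
  obtain ⟨s, hlt, hs⟩ := exists_lt_forall_mem_iff (bound φ.code) (Formula.code '' σ)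
  have mem_iff (ψ : Formula Var ar) (h : ψ.code < bound φ.code) : Mem ψ.code s ↔ ψ ∈ σ := by
    rw [hs, and_iff_right h, code_injective.mem_set_image]
  exact ⟨s, hlt, fun ψ hψ => mem_iff ψ (code_lt_bound hψ),
    fun X hX Y hY => mem_iff (Dep X Y) (node_codeSet_lt_bound hX hY (by norm_num)),
    fun X hX Y hY => mem_iff (KDep X Y) (node_codeSet_lt_bound hX hY (by norm_num)),
    fun X hX Y hY => mem_iff (UDep X Y) (node_codeSet_lt_bound hX hY (by norm_num))⟩

theorem exists_codesTypes (φ : Formula Var ar) (W : Set (Set (Formula Var ar))) :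
    ∃ w < 2 ^ 2 ^ bound φ.code, CodesTypes φ.vars φ.subformulas w W := by
  choose num num_lt codesType_num using exists_codesType φ
  obtain ⟨w, hlt, hw⟩ := exists_lt_forall_mem_iff (2 ^ bound φ.code) (num '' W)
  refine ⟨w, hlt, fun s hs => ?_, fun σ hσ =>
    ⟨num σ, (hw _).2 ⟨num_lt σ, σ, hσ, rfl⟩, codesType_num σ⟩⟩
  obtain ⟨-, σ, hσ, rfl⟩ := (hw s).1 hs
  exact ⟨σ, hσ, codesType_num σ⟩

theorem CodesTypes.exists_notMem_iff {w : ℕ} {W : Set (Set (Formula Var ar))}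
    (hw : CodesTypes φ.vars φ.subformulas w W) :
    (∃ s < w, Mem s w ∧ ¬ Mem φ.code s) ↔ ∃ σ ∈ W, φ ∉ σ :=
  hw.exists_iff fun _ _ hs => not_congr (hs.mem φ φ.self_mem_subformulas)

theorem refutable_code_iff :
    Refutable φ.code ↔ ∃ W, LUD.QuasiModel φ.vars φ.subformulas W ∧ ∃ σ ∈ W, φ ∉ σ := by
  constructor
  · rintro ⟨v, -, p, -, hc, w, -, hq, hφ⟩
    obtain ⟨rfl, hp⟩ := isClosure_iff.1 hc
    have hw := codesTypes_image_formulas φ.vars φ.subformulas w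
    exact ⟨_, (hw.quasiModel_iff hp).1 hq, hw.exists_notMem_iff.1 hφ⟩
  · rintro ⟨W, hq, hφ⟩
    obtain ⟨p, hlt, hp⟩ := exists_codesFormulas φ
    obtain ⟨w, hwlt, hw⟩ := exists_codesTypes φ W
    exact ⟨_, codeSet_lt_of_subset_vars subset_rfl, p, hlt, isClosure_iff.2 ⟨rfl, hp⟩, w, hwlt,
      (hw.quasiModel_iff hp).2 hq, hw.exists_notMem_iff.2 hφ⟩

end Decidability

end Coded

theorem decidableFormulas_metricValid {Var Pred : Type u} [Encodable Var] [Encodable Pred]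
    (ar : Pred → ℕ) : DecidableFormulas fun φ : Formula Var ar => MetricValid φ := by
  classical
  refine ⟨fun n => decide (¬ Coded.Refutable n), Coded.primrecPred_refutable.not.decide.to_comp,
    fun φ => ?_⟩
  rw [decide_eq_true_iff, Coded.refutable_code_iff, exists_quasiModel_iff_not_metricValid, not_not]

end LUD

theorem mainTheorem2 {Var Pred : Type u} [DecidableEq Var] (ar : Pred → ℕ) :
    (∀ φ : LUD.Formula Var ar, LUD.Provable φ ↔ LUD.MetricValid φ) ∧
    (∀ φ : LUD.Formula Var ar, LUD.Provable φ ↔ LUD.ConcreteValid φ) ∧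
    (∀ φ : LUD.Formula Var ar, LUD.Provable φ ↔ LUD.LipschitzValid φ) ∧
    (∀ [Encodable Var] [Encodable Pred],
      LUD.DecidableFormulas (fun φ : LUD.Formula Var ar => LUD.MetricValid φ)) :=
  ⟨fun φ => (LUD.provable_tfae φ).out 0 1, fun φ => (LUD.provable_tfae φ).out 0 2,
    fun φ => (LUD.provable_tfae φ).out 0 3, LUD.decidableFormulas_metricValid ar⟩
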